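/- Let $\varepsilon\in(0,1/2]$ be a constant and put $\beta=\tfrac12\ln\frac{1}{2\varepsilon}$. There is a randomized polynomial-time algorithm with the following guarantee. An instance consists of a finite ground set $\mathcal N$ with $n=|\mathcal N|$ elements, a set function $f\colon 2^{\mathcal N}\to\mathbb R_{\ge 0}$ that is submodular ($f(S\cup\{u\})-f(S)\ge f(T\cup\{u\})-f(T)$ whenever $S\subseteq T\subseteq\mathcal N$ and $u\in\mathcal N\setminus T$) and symmetric ($f(S)=f(\mathcal N\setminus S)$ for all $S$), and a non-empty convex set $\mathcal P\subseteq[0,1]^{\mathcal N}$ that is down-closed ($y\in\mathcal P$ and $0\le x\le y$ imply $x\in\mathcal P$) and solvable. The algorithm accesses $f$ through a value oracle (given $S$, it returns $f(S)$) and $\mathcal P$ through a linear optimization oracle (given $w\in\mathbb R^{\mathcal N}$, it returns a point of $\mathcal P$ maximizing $\langle w,x\rangle$ over $x\in\mathcal P$). It is a uniform program of a real RAM with oracle queries and fair coin tosses that has $\varepsilon$ as a constant; arithmetic operations, comparisons and coin tosses take unit time, and an oracle query takes time $n+1$. Let $F(x)=\sum_{S\subseteq\mathcal N}f(S)\prod_{u\in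 S}x_u\prod_{u\notin S}(1-x_u)$ be the multilinear extension of $f$, and let $\mathrm{OPT}$ be a set maximizing $f(S)$ among all $S\subseteq\mathcal N$ with $\mathbf 1_S\in\mathcal P$. There are a polynomial $q$ and a function $\eta\colon\mathbb N\to\mathbb R$ with $\eta(n)\to0$ as $n\to\infty$, both depending only on $\varepsilon$, such that on every instance the algorithm always halts within $q(n)$ steps and outputs a vector $x\in[0,1]^{\mathcal N}$ for which there are $y_1,y_2\in\mathcal P$ with $y_1\le x\le\beta y_2$ (coordinate-wise), and $$\mathbb E[F(x)]\ \ge\ \Big(\tfrac12-\varepsilon-\eta(n)\Big)f(\mathrm{OPT}),$$ and moreover $\Pr\big[F(x)\ge(\tfrac12-\varepsilon-\eta(n))f(\mathrm{OPT})\big]\ge 1-\eta(n)$. That is, the algorithm is a polynomial-time $(\tfrac12-\varepsilon-o(1),\ \tfrac12\ln\frac1{2\varepsilon})$-bicriteria integer-approximation algorithm for maximizing $F$ subject to $\mathcal P$. -/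

import Mathlib

open Filter Topology
open scoped BigOperators

noncomputable section

/-! ### Set functions, convex constraints and bicriteria guarantees -/

/-- Diminishing returns. -/
def IsSubmodular {n : ℕ} (f : Finset (Fin n) → ℝ) : Prop :=
  ∀ S T : Finset (Fin n), S ⊆ T → ∀ u, u ∉ T → f (insert u T) - f T ≤ f (insert u S) - f S

/-- A set function is symmetric if every set has the same value as its complement. -/
def IsSymmetricSetFun {n : ℕ} (f : Finset (Fin n) → ℝ) : Prop :=
  ∀ S : Finset (Fin n), f Sᶜ = f S

/-- `F(x) = 𝔼 f(R(x))`, where `R(x)` contains every `u` independently with probability `x u`. -/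
def multilinearExt {n : ℕ} (f : Finset (Fin n) → ℝ) (x : Fin n → ℝ) : ℝ :=
  ∑ S : Finset (Fin n), f S * ((∏ u ∈ S, x u) * ∏ u ∈ Sᶜ, (1 - x u))

/-- The characteristic vector of a set. -/
def charVec {n : ℕ} (S : Finset (Fin n)) : Fin n → ℝ :=
  fun u => if u ∈ S then 1 else 0

def IsDownClosed {n : ℕ} (P : Set (Fin n → ℝ)) : Prop :=
  ∀ y ∈ P, ∀ x : Fin n → ℝ, 0 ≤ x → x ≤ y → x ∈ P

/-- `S` is an optimal integral solution of `max {f(S) : charVec S ∈ P}`. -/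
def IsIntegerOptimum {n : ℕ} (f : Finset (Fin n) → ℝ) (P : Set (Fin n → ℝ))
    (S : Finset (Fin n)) : Prop :=
  charVec S ∈ P ∧ ∀ S' : Finset (Fin n), charVec S' ∈ P → f S' ≤ f S

/-- The vectors that an algorithm of infeasibility ratio `β` may output. -/
def IsBicriteriaFeasible {n : ℕ} (P : Set (Fin n → ℝ)) (β : ℝ) (x : Fin n → ℝ) : Prop :=
  (∀ u, 0 ≤ x u ∧ x u ≤ 1) ∧ ∃ y₁ ∈ P, ∃ y₂ ∈ P, y₁ ≤ x ∧ x ≤ β • y₂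

/-- `O` solves linear optimization over `P` exactly: `O w` is a point of `P` that maximizes the
inner product with `w`. -/
def IsLinOptOracle {n : ℕ} (P : Set (Fin n → ℝ)) (O : (Fin n → ℝ) → (Fin n → ℝ)) : Prop :=
  ∀ w, O w ∈ P ∧ ∀ y ∈ P, ∑ u, w u * y u ≤ ∑ u, w u * O w u

/-! ### The machine model

A randomized real RAM with two oracles, programmed in a structured language.  The machine has
natural-number registers `reg`, which serve as counters and as addresses, a memory `mem` of real
cells, and a tape of fair coins which is read once, from left to right.  Every real operand of an
instruction is addressed indirectly, through a register.  A program is a finite object that does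
not depend on the size of the ground set, on the objective function or on the constraint. -/

namespace RealRAM

/-- Tests for the control flow: compare two registers, or two memory cells. -/
inductive Test : Type
  | regLt (a b : ℕ) : Test
  | memLt (a b : ℕ) : Test

/-- Programs. -/
inductive Prog : Type
  | skip : Prog
  /-- `reg d := k` -/
  | regConst (d k : ℕ) : Prog
  /-- `reg d := n`, the size of the ground set -/
  | regSize (d : ℕ) : Prog
  /-- `reg d := reg a + reg b` -/
  | regAdd (d a b : ℕ) : Prog
  /-- `reg d := reg a - reg b` (truncated at `0`) -/
  | regSub (d a b : ℕ) : Prog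
  /-- `mem[reg d] := q` -/
  | memConst (d : ℕ) (q : ℚ) : Prog
  /-- `mem[reg d] := ε`, the constant parameter of the algorithm -/
  | memParam (d : ℕ) : Prog
  /-- `mem[reg d] := mem[reg a] + mem[reg b]`, and likewise for the other operations -/
  | memAdd (d a b : ℕ) : Prog
  | memSub (d a b : ℕ) : Prog
  | memMul (d a b : ℕ) : Prog
  /-- division, with the convention `x / 0 = 0` -/
  | memDiv (d a b : ℕ) : Prog
  /-- toss a fair coin: `mem[reg d] := 0` or `mem[reg d] := 1` -/
  | coin (d : ℕ) : Prog
  /-- value query: `mem[reg d] := f S`, where `u ∈ S` iff `mem[reg a + u] ≠ 0` -/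
  | value (d a : ℕ) : Prog
  /-- linear optimization query: the `n` cells from `mem[reg d]` on receive the answer to the
  query whose weights are in the `n` cells from `mem[reg a]` on -/
  | linOpt (d a : ℕ) : Prog
  | seq (p q : Prog) : Prog
  | ite (b : Test) (p q : Prog) : Prog
  | while (b : Test) (p : Prog) : Prog

structure State : Type where
  reg : ℕ → ℕ
  mem : ℕ → ℝ
  tape : List Bool

/-- What a program can access: the parameter and the two oracles of an instance whose ground set
is `Fin n`. -/
structure Env (n : ℕ) : Type where
  param : ℝ
  value : Finset (Fin n) → ℝ
  linOpt : (Fin n → ℝ) → (Fin n → ℝ)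

def State.setReg (s : State) (d k : ℕ) : State :=
  { s with reg := Function.update s.reg d k }

/-- Write a number in the cell whose address is in register `d`. -/
def State.setMem (s : State) (d : ℕ) (x : ℝ) : State :=
  { s with mem := Function.update s.mem (s.reg d) x }

/-- The content of the cell whose address is in register `a`. -/
def State.get (s : State) (a : ℕ) : ℝ :=
  s.mem (s.reg a)

/-- The vector stored in the `n` cells from address `k` on. -/
def State.vec (s : State) (n k : ℕ) : Fin n → ℝ :=
  fun u => s.mem (k + u)

/-- The set whose indicator is stored in the `n` cells from address `k` on. -/
def State.set (s : State) (n k : ℕ) : Finset (Fin n) :=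
  {u | s.mem (k + u) ≠ 0}

/-- Store the vector `x` in the `n` cells from address `k` on. -/
def State.setVec (s : State) {n : ℕ} (k : ℕ) (x : Fin n → ℝ) : State :=
  { s with mem := fun i => if h : k ≤ i ∧ i - k < n then x ⟨i - k, h.2⟩ else s.mem i }

def Test.holds (b : Test) (s : State) : Prop :=
  match b with
  | .regLt a b => s.reg a < s.reg b
  | .memLt a b => s.get a < s.get b

/-- `Exec E p s s' t`: program `p`, started in state `s`, halts in state `s'` after `t` steps.
Elementary instructions and tests take one step, oracle queries take `n + 1` steps.  A coin can
only be tossed while there are coins left on the tape. -/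
inductive Exec {n : ℕ} (E : Env n) : Prog → State → State → ℕ → Prop
  | skip (s : State) : Exec E .skip s s 1
  | regConst (s : State) (d k : ℕ) : Exec E (.regConst d k) s (s.setReg d k) 1
  | regSize (s : State) (d : ℕ) : Exec E (.regSize d) s (s.setReg d n) 1
  | regAdd (s : State) (d a b : ℕ) :
      Exec E (.regAdd d a b) s (s.setReg d (s.reg a + s.reg b)) 1
  | regSub (s : State) (d a b : ℕ) :
      Exec E (.regSub d a b) s (s.setReg d (s.reg a - s.reg b)) 1
  | memConst (s : State) (d : ℕ) (q : ℚ) : Exec E (.memConst d q) s (s.setMem d (q : ℝ)) 1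
  | memParam (s : State) (d : ℕ) : Exec E (.memParam d) s (s.setMem d E.param) 1
  | memAdd (s : State) (d a b : ℕ) :
      Exec E (.memAdd d a b) s (s.setMem d (s.get a + s.get b)) 1
  | memSub (s : State) (d a b : ℕ) :
      Exec E (.memSub d a b) s (s.setMem d (s.get a - s.get b)) 1
  | memMul (s : State) (d a b : ℕ) :
      Exec E (.memMul d a b) s (s.setMem d (s.get a * s.get b)) 1
  | memDiv (s : State) (d a b : ℕ) :
      Exec E (.memDiv d a b) s (s.setMem d (s.get a / s.get b)) 1
  | coin (s : State) (d : ℕ) (c : Bool) (l : List Bool) (h : s.tape = c :: l) :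
      Exec E (.coin d) s (({ s with tape := l } : State).setMem d (if c then 1 else 0)) 1
  | value (s : State) (d a : ℕ) :
      Exec E (.value d a) s (s.setMem d (E.value (s.set n (s.reg a)))) (n + 1)
  | linOpt (s : State) (d a : ℕ) :
      Exec E (.linOpt d a) s (s.setVec (s.reg d) (E.linOpt (s.vec n (s.reg a)))) (n + 1)
  | seq {p q : Prog} {s s' s'' : State} {t t' : ℕ} (h : Exec E p s s' t)
      (h' : Exec E q s' s'' t') : Exec E (.seq p q) s s'' (t + t')
  | iteTrue {b : Test} {p q : Prog} {s s' : State} {t : ℕ} (hb : b.holds s)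
      (h : Exec E p s s' t) : Exec E (.ite b p q) s s' (t + 1)
  | iteFalse {b : Test} {p q : Prog} {s s' : State} {t : ℕ} (hb : ¬ b.holds s)
      (h : Exec E q s s' t) : Exec E (.ite b p q) s s' (t + 1)
  | whileTrue {b : Test} {p : Prog} {s s' s'' : State} {t t' : ℕ} (hb : b.holds s)
      (h : Exec E p s s' t) (h' : Exec E (.while b p) s' s'' t') :
      Exec E (.while b p) s s'' (t + t' + 1)
  | whileFalse {b : Test} {p : Prog} {s : State} (hb : ¬ b.holds s) :
      Exec E (.while b p) s s 1

/-- Executions are deterministic once the coins are fixed. -/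
theorem Exec.unique {n : ℕ} {E : Env n} {p : Prog} {s s₁ s₂ : State} {t₁ t₂ : ℕ}
    (h₁ : Exec E p s s₁ t₁) (h₂ : Exec E p s s₂ t₂) : s₁ = s₂ ∧ t₁ = t₂ := by
  induction h₁ generalizing s₂ t₂ with
  | coin s d c l h =>
    cases h₂ with
    | coin _ _ c' l' h' =>
      rw [h] at h'
      cases h'
      exact ⟨rfl, rfl⟩
  | seq _ _ ih ih' =>
    cases h₂ with
    | seq k k' =>
      obtain ⟨rfl, rfl⟩ := ih k
      obtain ⟨rfl, rfl⟩ := ih' k'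
      exact ⟨rfl, rfl⟩
  | iteTrue hb _ ih =>
    cases h₂ with
    | iteTrue _ k =>
      obtain ⟨rfl, rfl⟩ := ih k
      exact ⟨rfl, rfl⟩
    | iteFalse hb' _ => exact absurd hb hb'
  | iteFalse hb _ ih =>
    cases h₂ with
    | iteTrue hb' _ => exact absurd hb' hb
    | iteFalse _ k =>
      obtain ⟨rfl, rfl⟩ := ih k
      exact ⟨rfl, rfl⟩
  | whileTrue hb _ _ ih ih' =>
    cases h₂ with
    | whileTrue _ k k' =>
      obtain ⟨rfl, rfl⟩ := ih k
      obtain ⟨rfl, rfl⟩ := ih' k'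
      exact ⟨rfl, rfl⟩
    | whileFalse hb' => exact absurd hb hb'
  | whileFalse hb =>
    cases h₂ with
    | whileTrue hb' _ _ => exact absurd hb' hb
    | whileFalse _ => exact ⟨rfl, rfl⟩
  | _ => cases h₂; exact ⟨rfl, rfl⟩

/-- Initially all registers and cells are `0`, and `r` is on the tape. -/
def initState (r : List Bool) : State where
  reg := fun _ => 0
  mem := fun _ => 0
  tape := r

/-- With the coins `r`, the program `p` halts within `m` steps and outputs `x`, which is read off
the first `n` cells of the memory. -/
def HaltsWithin {n : ℕ} (E : Env n) (p : Prog) (r : List Bool) (m : ℕ) (x : Fin n → ℝ) : Prop :=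
  ∃ s t, Exec E p (initState r) s t ∧ t ≤ m ∧ s.vec n 0 = x

end RealRAM

/-- The average of `g` over all outcomes of `m` independent fair coins. -/
def coinExpect {m : ℕ} (g : (Fin m → Bool) → ℝ) : ℝ :=
  (∑ r : Fin m → Bool, g r) / 2 ^ m

open Classical in
/-- The probability of an event that depends on `m` independent fair coins. -/
def coinProb {m : ℕ} (A : (Fin m → Bool) → Prop) : ℝ :=
  coinExpect fun r => if A r then 1 else 0

end

/-! Let `F` be the multilinear extension and `∂_u F` its partial derivatives. Everything rests on
one inequality (`IsSubmodular.le_sum_marginal`): for `x` in the cube and any set `S`, `∑_{u ∈ S} (1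
- 2 x_u) ∂_u F(x) ≥ f(S) - 2 F(x)`. Since `∂_u F(x)` is the expected marginal value of `u` and is
independent of whether `u` lies in the random set `R`, the left side is the expected gain from
adding elements of `S \ R` minus the expected gain attributable to elements of `S ∩ R`.
Submodularity bounds it below by `E[f(R ∪ S) + f(R \ S) - 2 f(R)]`. By symmetry `f(R \ S)` is the
value of the complement of `R \ S`, which meets `R ∪ S` exactly in `S`; submodularity and
nonnegativity then give `f(R ∪ S) + f(R \ S) ≥ f(S)`.

Hence continuous greedy with velocity `(1 - 2x) * y`, where `y ∈ P` maximizes the linear form with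
weights `(1 - 2 x_u) ∂_u F(x)`, satisfies `F' ≥ f(OPT) - 2F`. At time `t` this gives `F ≥ (1 -
exp(-2t)) / 2 * f(OPT)`, which is `(1/2 - ε) f(OPT)` at `t = β`. The coordinates stay in `[0, 1/2]`,
and `x` is dominated by `t` times an average of points of `P`.

The discrete version takes steps of length `1/T` with `T = (n+2)^4` and estimates each derivative
from `T` samples. Elements whose singleton is infeasible are frozen, so every marginal that matters
is at most `f {u} ≤ f(OPT)` in absolute value (`IsSubmodular.abs_marginal_le`). A step then loses
`O(n^3 / T^2) f(OPT)` in expectation (`move_progress`, `mean_step_le`), and the `O(T)` steps lose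
`O(1/n) f(OPT)`. What is propagated is the expected positive part of the shortfall
(`mean_greedy_le`): it yields the bound on the expectation, and by Markov's inequality also the
bound in probability.

For the machine, the algorithm is first written as a tree of coin tosses (`CoinTree`), on which
expectations, sure properties and the number of coins are computed by recursion. The relation `Sim`
then shows that `greedyProg` follows this tree within a polynomial number of steps (`sim_greedy`).
-/

/-! ### Computations that toss fair coins -/

/-- A computation that tosses finitely many fair coins and returns an element of `α`. -/
inductive CoinTree (α : Type) : Type
  | ret (a : α) : CoinTree α
  | flip (k : Bool → CoinTree α) : CoinTree α

namespace CoinTree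

variable {α β : Type}

def bind : CoinTree α → (α → CoinTree β) → CoinTree β
  | ret a, g => g a
  | flip k, g => flip fun c => bind (k c) g

/-- Run `f i, f (i + 1), …, f (i + k - 1)`, feeding the outcome of each to the next. -/
def loop (f : ℕ → α → CoinTree α) : ℕ → ℕ → α → CoinTree α
  | _, 0, a => ret a
  | i, k + 1, a => (f i a).bind (loop f (i + 1) k)

/-- The expectation of `φ` of the outcome. -/
noncomputable def mean : CoinTree α → (α → ℝ) → ℝ
  | ret a, φ => φ a
  | flip k, φ => (mean (k true) φ + mean (k false) φ) / 2

/-- All possible outcomes satisfy `p`. -/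
def All (p : α → Prop) : CoinTree α → Prop
  | ret a => p a
  | flip k => ∀ c, All p (k c)

/-- At most `d` coins are tossed. -/
def DepthLE : CoinTree α → ℕ → Prop
  | ret _, _ => True
  | flip _, 0 => False
  | flip k, d + 1 => ∀ c, DepthLE (k c) d

/-- The outcome on a given tape of coins together with the unused coins; `none` if there are too
few coins. -/
def run : CoinTree α → List Bool → Option (α × List Bool)
  | ret a, l => some (a, l)
  | flip _, [] => none
  | flip k, c :: l => run (k c) l

theorem bind_assoc {γ : Type} (t : CoinTree α) (g : α → CoinTree β) (g' : β → CoinTree γ) :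
    (t.bind g).bind g' = t.bind fun a => (g a).bind g' := by
  induction t with
  | ret a => rfl
  | flip k ih => simp only [bind, ih]

theorem mean_bind (t : CoinTree α) (g : α → CoinTree β) (φ : β → ℝ) :
    (t.bind g).mean φ = t.mean fun a => (g a).mean φ := by
  induction t with
  | ret a => rfl
  | flip k ih => simp only [bind, mean, ih]

theorem mean_const (t : CoinTree α) (c : ℝ) : t.mean (fun _ => c) = c := by
  induction t with
  | ret a => rfl
  | flip k ih => simp only [mean, ih]; ring

theorem mean_add (t : CoinTree α) (φ ψ : α → ℝ) :
    t.mean (fun a => φ a + ψ a) = t.mean φ + t.mean ψ := by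
  induction t with
  | ret a => rfl
  | flip k ih => simp only [mean, ih]; ring

theorem mean_const_mul (t : CoinTree α) (c : ℝ) (φ : α → ℝ) :
    t.mean (fun a => c * φ a) = c * t.mean φ := by
  induction t with
  | ret a => rfl
  | flip k ih => simp only [mean, ih]; ring

theorem mean_affine (t : CoinTree α) (a b : ℝ) (φ : α → ℝ) :
    t.mean (fun z => a + φ z * b) = a + t.mean φ * b := by
  induction t with
  | ret a => rfl
  | flip k ih => simp only [mean, ih]; ring

theorem mean_sum {ι : Type} (t : CoinTree α) (s : Finset ι) (φ : ι → α → ℝ) :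
    t.mean (fun a => ∑ i ∈ s, φ i a) = ∑ i ∈ s, t.mean (φ i) := by
  classical
  induction s using Finset.induction_on with
  | empty => simp [mean_const]
  | insert i s hi ih => simp only [Finset.sum_insert hi, mean_add, ih]

theorem All.mono {p q : α → Prop} {t : CoinTree α} (h : t.All p) (hpq : ∀ a, p a → q a) :
    t.All q := by
  induction t with
  | ret a => exact hpq a h
  | flip k ih => exact fun c => ih c (h c)

theorem All.of_forall {p : α → Prop} (t : CoinTree α) (h : ∀ a, p a) : t.All p := by
  induction t with
  | ret a => exact h a
  | flip k ih => exact fun c => ih c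

theorem All.bind {p : α → Prop} {q : β → Prop} {t : CoinTree α} {g : α → CoinTree β}
    (h : t.All p) (hg : ∀ a, p a → (g a).All q) : (t.bind g).All q := by
  induction t with
  | ret a => exact hg a h
  | flip k ih => exact fun c => ih c (h c)

theorem All.loop {f : ℕ → α → CoinTree α} {p : ℕ → α → Prop} (k : ℕ) :
    ∀ (i : ℕ) (a : α), p i a → (∀ j a, i ≤ j → j < i + k → p j a → (f j a).All (p (j + 1))) →
      (CoinTree.loop f i k a).All (p (i + k)) := by
  induction k with
  | zero => exact fun i a h _ => h
  | succ k ih =>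
    intro i a h hf
    refine (hf i a le_rfl (by omega) h).bind fun b hb => ?_
    have := ih (i + 1) b hb fun j a h₁ h₂ => hf j a (by omega) (by omega)
    rwa [show i + 1 + k = i + (k + 1) by omega] at this

theorem mean_le_mean {t : CoinTree α} {φ ψ : α → ℝ} (h : t.All fun a => φ a ≤ ψ a) :
    t.mean φ ≤ t.mean ψ := by
  induction t with
  | ret a => exact h
  | flip k ih =>
    have h₁ := ih true (h true)
    have h₂ := ih false (h false)
    simp only [mean]
    linarith

theorem mean_congr {t : CoinTree α} {φ ψ : α → ℝ} (h : t.All fun a => φ a = ψ a) :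
    t.mean φ = t.mean ψ :=
  le_antisymm (mean_le_mean (h.mono fun _ h => h.le)) (mean_le_mean (h.mono fun _ h => h.ge))

theorem mean_sq_le (t : CoinTree α) (φ : α → ℝ) : t.mean φ ^ 2 ≤ t.mean fun a => φ a ^ 2 := by
  induction t with
  | ret a => exact le_rfl
  | flip k ih =>
    have h₁ := ih true
    have h₂ := ih false
    simp only [mean]
    nlinarith [sq_nonneg ((k true).mean φ - (k false).mean φ)]

theorem DepthLE.mono {t : CoinTree α} {d e : ℕ} (h : t.DepthLE d) (hde : d ≤ e) :
    t.DepthLE e := by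
  induction t generalizing d e with
  | ret a => trivial
  | flip k ih =>
    cases d with
    | zero => exact h.elim
    | succ d =>
      obtain ⟨e, rfl⟩ : ∃ e', e = e' + 1 := ⟨e - 1, by omega⟩
      exact fun c => ih c (h c) (by omega)

theorem DepthLE.bind {t : CoinTree α} {g : α → CoinTree β} {d e : ℕ} (h : t.DepthLE d)
    (hg : ∀ a, (g a).DepthLE e) : (t.bind g).DepthLE (d + e) := by
  induction t generalizing d with
  | ret a => exact (hg a).mono (by omega)
  | flip k ih =>
    cases d with
    | zero => exact h.elim
    | succ d =>
      rw [show d + 1 + e = (d + e) + 1 by omega]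
      exact fun c => ih c (h c)

theorem DepthLE.loop {f : ℕ → α → CoinTree α} {d : ℕ} (hf : ∀ i a, (f i a).DepthLE d) (k : ℕ) :
    ∀ i a, (CoinTree.loop f i k a).DepthLE (k * d) := by
  induction k with
  | zero => exact fun i a => trivial
  | succ k ih =>
    intro i a
    rw [show (k + 1) * d = d + k * d by ring]
    exact (hf i a).bind fun b => ih _ b

theorem run_bind (t : CoinTree α) (g : α → CoinTree β) (l : List Bool) :
    (t.bind g).run l = (t.run l).bind fun r => (g r.1).run r.2 := by
  induction t generalizing l with
  | ret a => rfl
  | flip k ih =>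
    cases l with
    | nil => rfl
    | cons c l => exact ih c l

theorem DepthLE.exists_run {t : CoinTree α} {l : List Bool} (h : t.DepthLE l.length) :
    ∃ r, t.run l = some r := by
  induction t generalizing l with
  | ret a => exact ⟨_, rfl⟩
  | flip k ih =>
    cases l with
    | nil => exact h.elim
    | cons c l => exact ih c (h c)

/-- Used for feasibility, which must hold for every outcome of the coins and not only with high
probability. -/
theorem All.of_run {p : α → Prop} {t : CoinTree α} (h : t.All p) {l : List Bool}
    {r : α × List Bool} (hr : t.run l = some r) : p r.1 := by
  induction t generalizing l with
  | ret a => cases hr; exact h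
  | flip k ih =>
    cases l with
    | nil => cases hr
    | cons c l => exact ih c (h c) hr

theorem coinExpect_succ {m : ℕ} (g : (Fin (m + 1) → Bool) → ℝ) :
    coinExpect g = (coinExpect (fun r : Fin m → Bool => g (Fin.cons true r)) +
      coinExpect (fun r : Fin m → Bool => g (Fin.cons false r))) / 2 := by
  unfold coinExpect
  rw [← (Fin.consEquiv fun _ : Fin (m + 1) => Bool).sum_comp, Fintype.sum_prod_type]
  simp only [Fintype.sum_bool, Fin.consEquiv, Equiv.coe_fn_mk]
  field_simp
  ring

theorem coinExpect_const {m : ℕ} (c : ℝ) : coinExpect (fun _ : Fin m → Bool => c) = c := by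
  simp [coinExpect]

/-- With enough fair coins, the expectation over the coins is `mean`. -/
theorem coinExpect_eq_mean {t : CoinTree α} {m : ℕ} (h : t.DepthLE m) (φ : α → ℝ)
    (out : (Fin m → Bool) → α) (hout : ∀ r, ∃ l, t.run (List.ofFn r) = some (out r, l)) :
    coinExpect (fun r => φ (out r)) = t.mean φ := by
  induction t generalizing m with
  | ret a =>
    have : ∀ r, out r = a := fun r => by
      obtain ⟨l, hl⟩ := hout r
      cases hl
      rfl
    simp only [this, coinExpect_const, mean]
  | flip k ih =>
    cases m with
    | zero => exact h.elim
    | succ m =>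
      -- Condition on the first coin. A branch may use fewer than `m` coins; the unused ones average
      -- out in the case `ret`.
      have key : ∀ c, coinExpect (fun r : Fin m → Bool => φ (out (Fin.cons c r))) =
          (k c).mean φ := by
        intro c
        refine ih c (h c) (fun r => out (Fin.cons c r)) fun r => ?_
        obtain ⟨l, hl⟩ := hout (Fin.cons c r)
        refine ⟨l, ?_⟩
        rw [List.ofFn_succ] at hl
        simpa [run] using hl
      rw [coinExpect_succ, key, key]
      rfl

end CoinTree

/-! ### The multilinear extension -/

section Multilinear

variable {n : ℕ}

theorem insert_erase_eq_insert (u : Fin n) (S : Finset (Fin n)) :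
    insert u (S.erase u) = insert u S := by
  ext v
  by_cases h : v = u <;> simp [h]

theorem multilinearExt_add (f g : Finset (Fin n) → ℝ) (x : Fin n → ℝ) :
    multilinearExt (fun S => f S + g S) x = multilinearExt f x + multilinearExt g x := by
  simp only [multilinearExt, add_mul, Finset.sum_add_distrib]

theorem multilinearExt_const_mul (c : ℝ) (f : Finset (Fin n) → ℝ) (x : Fin n → ℝ) :
    multilinearExt (fun S => c * f S) x = c * multilinearExt f x := by
  simp only [multilinearExt, mul_assoc, Finset.mul_sum]

theorem multilinearExt_sum {ι : Type} (s : Finset ι) (f : ι → Finset (Fin n) → ℝ)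
    (x : Fin n → ℝ) :
    multilinearExt (fun S => ∑ i ∈ s, f i S) x = ∑ i ∈ s, multilinearExt (f i) x := by
  simp only [multilinearExt, Finset.sum_mul]
  exact Finset.sum_comm

theorem multilinearExt_const (c : ℝ) (x : Fin n → ℝ) :
    multilinearExt (fun _ => c) x = c := by
  have h := Finset.prod_add x (fun u => 1 - x u) Finset.univ
  simp only [add_sub_cancel, Finset.prod_const_one] at h
  simp only [multilinearExt, ← Finset.mul_sum, Finset.compl_eq_univ_sdiff]
  rw [← Finset.powerset_univ, ← h, mul_one]

theorem multilinearExt_mono {f g : Finset (Fin n) → ℝ} {x : Fin n → ℝ}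
    (hx : ∀ u, 0 ≤ x u ∧ x u ≤ 1) (h : ∀ S, f S ≤ g S) :
    multilinearExt f x ≤ multilinearExt g x := by
  refine Finset.sum_le_sum fun S _ => mul_le_mul_of_nonneg_right (h S) (mul_nonneg ?_ ?_)
  · exact Finset.prod_nonneg fun u _ => (hx u).1
  · exact Finset.prod_nonneg fun u _ => sub_nonneg.2 (hx u).2

theorem multilinearExt_nonneg {f : Finset (Fin n) → ℝ} {x : Fin n → ℝ}
    (hx : ∀ u, 0 ≤ x u ∧ x u ≤ 1) (h : ∀ S, 0 ≤ f S) : 0 ≤ multilinearExt f x := by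
  simpa only [multilinearExt_const] using multilinearExt_mono (f := fun _ => 0) hx h

theorem multilinearExt_le {f : Finset (Fin n) → ℝ} {x : Fin n → ℝ} {M : ℝ}
    (hx : ∀ u, 0 ≤ x u ∧ x u ≤ 1) (h : ∀ S, f S ≤ M) : multilinearExt f x ≤ M := by
  simpa only [multilinearExt_const] using multilinearExt_mono (g := fun _ => M) hx h

theorem abs_multilinearExt_le {f : Finset (Fin n) → ℝ} {x : Fin n → ℝ} {M : ℝ}
    (hx : ∀ u, 0 ≤ x u ∧ x u ≤ 1) (h : ∀ S, |f S| ≤ M) : |multilinearExt f x| ≤ M := by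
  refine abs_le.2 ⟨?_, multilinearExt_le hx fun S => (abs_le.1 (h S)).2⟩
  simpa only [multilinearExt_const] using
    multilinearExt_mono (f := fun _ => -M) hx fun S => (abs_le.1 (h S)).1

/-- Conditioning on whether `u` belongs to the random set. -/
theorem multilinearExt_split (f : Finset (Fin n) → ℝ) (x : Fin n → ℝ) (u : Fin n) :
    multilinearExt f x = (1 - x u) * multilinearExt (fun S => f (S.erase u)) x +
      x u * multilinearExt (fun S => f (insert u S)) x := by
  have key : ∀ g : Finset (Fin n) → ℝ, multilinearExt g x =
      ∑ S ∈ (Finset.univ.erase u).powerset,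
        (x u * g (insert u S) + (1 - x u) * g S) *
          ((∏ v ∈ S, x v) * ∏ v ∈ (Finset.univ.erase u) \ S, (1 - x v)) := by
    intro g
    have hu : (Finset.univ : Finset (Fin n)) = insert u (Finset.univ.erase u) := by simp
    rw [multilinearExt, ← Finset.powerset_univ]
    conv_lhs => rw [hu, Finset.powerset_insert]
    rw [Finset.sum_union, Finset.sum_image, ← Finset.sum_add_distrib]
    · refine Finset.sum_congr rfl fun S hS => ?_
      have huS : u ∉ S := fun h => by simpa using Finset.mem_powerset.1 hS h
      have h₁ : Sᶜ = insert u (Finset.univ.erase u \ S) := by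
        ext v
        by_cases hv : v = u <;> simp [hv, huS]
      have h₂ : (insert u S)ᶜ = Finset.univ.erase u \ S := by
        ext v
        simp
      rw [h₁, h₂, Finset.prod_insert huS, Finset.prod_insert (by simp)]
      ring
    · intro S hS S' hS' h
      have huS : u ∉ S := fun h => by simpa using Finset.mem_powerset.1 hS h
      have huS' : u ∉ S' := fun h => by simpa using Finset.mem_powerset.1 hS' h
      rw [← Finset.erase_insert huS, h, Finset.erase_insert huS']
    · rw [Finset.disjoint_left]
      rintro S hS hS'
      obtain ⟨S', -, rfl⟩ := Finset.mem_image.1 hS'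
      simpa using Finset.mem_powerset.1 hS (Finset.mem_insert_self u S')
  rw [key f, key, key, Finset.mul_sum, Finset.mul_sum, ← Finset.sum_add_distrib]
  refine Finset.sum_congr rfl fun S hS => ?_
  have huS : u ∉ S := fun h => by simpa using Finset.mem_powerset.1 hS h
  simp only [Finset.erase_insert_eq_erase, Finset.insert_idem, Finset.erase_eq_of_notMem huS]
  ring

theorem multilinearExt_congr_of_forall_ne {f : Finset (Fin n) → ℝ} {x x' : Fin n → ℝ}
    (u : Fin n) (hf : ∀ S, f (S.erase u) = f (insert u S)) (hx : ∀ v, v ≠ u → x v = x' v) :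
    multilinearExt f x = multilinearExt f x' := by
  have key : ∀ x : Fin n → ℝ, multilinearExt f x =
      multilinearExt f (Function.update x u 0) := by
    intro x
    simp only [multilinearExt]
    rw [← sub_eq_zero, ← Finset.sum_sub_distrib]
    -- Pair the sets that differ only in `u`. They have equal `f`-values, and their two weights add
    -- up to a product that does not involve the coordinate `u`.
    refine Finset.sum_involution (fun S _ => if u ∈ S then S.erase u else insert u S) ?_ ?_ ?_ ?_
    · intro S _
      have aux : ∀ S : Finset (Fin n), u ∉ S →
          (f S * ((∏ v ∈ S, x v) * ∏ v ∈ Sᶜ, (1 - x v)) -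
            f S * ((∏ v ∈ S, Function.update x u 0 v) *
              ∏ v ∈ Sᶜ, (1 - Function.update x u 0 v))) +
          (f (insert u S) * ((∏ v ∈ insert u S, x v) * ∏ v ∈ (insert u S)ᶜ, (1 - x v)) -
            f (insert u S) * ((∏ v ∈ insert u S, Function.update x u 0 v) *
              ∏ v ∈ (insert u S)ᶜ, (1 - Function.update x u 0 v))) = 0 := by
        intro S hu
        have hS := hf S
        rw [Finset.erase_eq_of_notMem hu] at hS
        have h₁ : Sᶜ = insert u (insert u S)ᶜ := by
          ext v
          by_cases hv : v = u <;> simp [hv, hu]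
        have h₂ : ∀ v ∈ S, Function.update x u 0 v = x v := fun v hv =>
          Function.update_of_ne (by rintro rfl; exact hu hv) _ _
        have h₃ : ∀ v ∈ (insert u S)ᶜ, 1 - Function.update x u 0 v = 1 - x v := fun v hv => by
          rw [Function.update_of_ne]
          rintro rfl
          simp at hv
        rw [h₁, Finset.prod_insert hu, Finset.prod_insert hu, Finset.prod_insert (by simp),
          Finset.prod_insert (by simp), Finset.prod_congr rfl h₂, Finset.prod_congr rfl h₃,
          Function.update_self, hS]
        ring
      by_cases hu : u ∈ S
      · have := aux (S.erase u) (by simp)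
        rw [Finset.insert_erase hu] at this
        simp only [hu, if_true]
        linarith
      · simpa only [hu, if_false] using aux S hu
    · intro S _ _
      by_cases hu : u ∈ S
      · simp only [hu, if_true, ne_eq, Finset.erase_eq_self, not_not]
      · simp only [hu, if_false, ne_eq, Finset.insert_eq_self, not_false_eq_true]
    · intros
      exact Finset.mem_univ _
    · intro S _
      by_cases hu : u ∈ S <;> simp [hu, Finset.insert_erase]
  rw [key x, key x']
  congr 1
  ext v
  by_cases hv : v = u
  · subst hv; simp
  · simp [hv, hx v hv]

/-- The marginal value of `u` with respect to a set. -/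
def marginal (f : Finset (Fin n) → ℝ) (u : Fin n) (S : Finset (Fin n)) : ℝ :=
  f (insert u S) - f (S.erase u)

theorem multilinearExt_marginal (f : Finset (Fin n) → ℝ) (x : Fin n → ℝ) (u : Fin n) :
    multilinearExt (marginal f u) x = multilinearExt (fun S => f (insert u S)) x -
      multilinearExt (fun S => f (S.erase u)) x := by
  simp only [multilinearExt, marginal, sub_mul, Finset.sum_sub_distrib]

/-- The multilinear extension is affine in every coordinate. -/
theorem multilinearExt_update (f : Finset (Fin n) → ℝ) (x : Fin n → ℝ) (u : Fin n) (t : ℝ) :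
    multilinearExt f (Function.update x u t) =
      multilinearExt f x + (t - x u) * multilinearExt (marginal f u) x := by
  have hx : ∀ v, v ≠ u → Function.update x u t v = x v := fun v hv => by simp [hv]
  -- Neither conditional expectation depends on the coordinate `u`, so the slope in that coordinate
  -- is the expected marginal value. This makes `multilinearExt (marginal f u)` the partial
  -- derivative of the multilinear extension.
  rw [multilinearExt_split f (Function.update x u t) u, multilinearExt_split f x u,
    multilinearExt_congr_of_forall_ne (f := fun S => f (S.erase u)) u (by simp) hx,
    multilinearExt_congr_of_forall_ne (f := fun S => f (insert u S)) u
      (by simp [insert_erase_eq_insert]) hx,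
    Function.update_self, multilinearExt_marginal]
  ring

/-- Replacing `x` by `x'` one coordinate at a time. -/
theorem abs_multilinearExt_sub_le {f : Finset (Fin n) → ℝ} {x x' : Fin n → ℝ} {M : ℝ}
    (hx : ∀ u, 0 ≤ x u ∧ x u ≤ 1) (hx' : ∀ u, 0 ≤ x' u ∧ x' u ≤ 1) (c : Fin n → ℝ) (r : Fin n → ℝ)
    (h : ∀ u z, (∀ v, 0 ≤ z v ∧ z v ≤ 1) → (∀ v, z v = x v ∨ z v = x' v) → x u ≠ x' u →
      |multilinearExt (marginal f u) z - c u| ≤ r u) (hM : ∑ u, |x' u - x u| * r u ≤ M) :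
    |multilinearExt f x' - multilinearExt f x - ∑ u, (x' u - x u) * c u| ≤ M := by
  -- Hybrid argument: the coordinates in `A` have already been replaced. Changing one more
  -- coordinate is exactly affine, with slope the derivative at the hybrid point. Only coordinates
  -- that really change are charged, which later spares the frozen ones.
  have key : ∀ A : Finset (Fin n),
      |multilinearExt f (fun v => if v ∈ A then x' v else x v) - multilinearExt f x -
        ∑ u ∈ A, (x' u - x u) * c u| ≤ ∑ u ∈ A, |x' u - x u| * r u := by
    intro A
    induction A using Finset.induction_on with
    | empty => simp
    | insert a A ha ih =>
      set z : Fin n → ℝ := fun v => if v ∈ A then x' v else x v with hz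
      have h₁ : (fun v => if v ∈ insert a A then x' v else x v) =
          Function.update z a (x' a) := by
        ext v
        by_cases hv : v = a
        · subst hv; simp
        · simp [hv, hz]
      have hza : z a = x a := by simp [hz, ha]
      have h₂ : |(x' a - x a) * (multilinearExt (marginal f a) z - c a)| ≤
          |x' a - x a| * r a := by
        by_cases hne : x a = x' a
        · simp [hne]
        · rw [abs_mul]
          refine mul_le_mul_of_nonneg_left (h a z (fun v => ?_) (fun v => ?_) hne) (abs_nonneg _)
          · simp only [hz]; split_ifs
            exacts [hx' v, hx v]
          · simp only [hz]; split_ifs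
            exacts [Or.inr rfl, Or.inl rfl]
      rw [h₁, multilinearExt_update, hza, Finset.sum_insert ha, Finset.sum_insert ha]
      refine le_trans (le_of_eq ?_) ((abs_add_le _ _).trans (add_le_add h₂ ih))
      congr 1
      ring
  have := key Finset.univ
  simp only [Finset.mem_univ, if_true] at this
  exact this.trans hM

theorem abs_multilinearExt_sub_le_of_abs_le {f : Finset (Fin n) → ℝ} {x x' : Fin n → ℝ} {M : ℝ}
    (hx : ∀ u, 0 ≤ x u ∧ x u ≤ 1) (hx' : ∀ u, 0 ≤ x' u ∧ x' u ≤ 1) (h : ∀ S, |f S| ≤ M) :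
    |multilinearExt f x' - multilinearExt f x| ≤ 2 * M * ∑ u, |x' u - x u| := by
  have := abs_multilinearExt_sub_le (f := f) hx hx' 0 (fun _ => 2 * M) (M := _)
    (fun u z hz _ _ => by
      rw [Pi.zero_apply, sub_zero]
      refine abs_multilinearExt_le hz fun S => (abs_sub _ _).trans ?_
      linarith [h (insert u S), h (S.erase u)]) le_rfl
  simpa [← Finset.sum_mul, mul_comm] using this

theorem multilinearExt_indicator (f : Finset (Fin n) → ℝ) {z : Fin n → ℝ}
    (hz : ∀ u, z u = 0 ∨ z u = 1) : multilinearExt f z = f {u | z u ≠ 0} := by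
  rw [multilinearExt, Finset.sum_eq_single ({u | z u ≠ 0} : Finset (Fin n))]
  · rw [Finset.prod_eq_one, Finset.prod_eq_one]
    · ring
    · intro u hu
      have : z u = 0 := by simpa using hu
      rw [this, sub_zero]
    · intro u hu
      exact (hz u).resolve_left (by simpa using hu)
  · intro S _ hS
    by_contra hne
    refine hS (Finset.ext fun u => ?_)
    have h₁ := left_ne_zero_of_mul (right_ne_zero_of_mul hne)
    have h₂ := right_ne_zero_of_mul (right_ne_zero_of_mul hne)
    rw [Finset.prod_ne_zero_iff] at h₁ h₂
    simp only [Finset.mem_filter, Finset.mem_univ, true_and]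
    refine ⟨h₁ u, fun h => ?_⟩
    by_contra hu
    exact h₂ u (by simpa using hu) (by rw [(hz u).resolve_left h, sub_self])
  · simp

end Multilinear

/-! ### Symmetric submodular functions -/

section Submodular

variable {n : ℕ} {f : Finset (Fin n) → ℝ}

theorem IsSubmodular.union_sub_le (hf : IsSubmodular f) {A B : Finset (Fin n)} (hAB : A ⊆ B)
    (C : Finset (Fin n)) (hC : Disjoint B C) : f (B ∪ C) - f B ≤ f (A ∪ C) - f A := by
  induction C using Finset.induction_on with
  | empty => simp
  | insert u C hu ih =>
    rw [Finset.disjoint_insert_right] at hC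
    have h₁ := ih hC.2
    have h₂ := hf (A ∪ C) (B ∪ C) (Finset.union_subset_union_left hAB) u (by simp [hC.1, hu])
    rw [Finset.union_insert, Finset.union_insert]
    linarith

theorem IsSubmodular.union_add_inter_le (hf : IsSubmodular f) (A B : Finset (Fin n)) :
    f (A ∪ B) + f (A ∩ B) ≤ f A + f B := by
  have h := hf.union_sub_le (A := A ∩ B) (B := A) Finset.inter_subset_left (B \ A)
    Finset.disjoint_sdiff
  have h₁ : A ∪ B \ A = A ∪ B := by simp
  have h₂ : A ∩ B ∪ B \ A = B := by ext; simp; tauto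
  rw [h₁, h₂] at h
  linarith

theorem IsSubmodular.marginal_le (hf : IsSubmodular f) (u : Fin n) (S : Finset (Fin n)) :
    marginal f u S ≤ f {u} - f ∅ := by
  have := hf ∅ (S.erase u) (by simp) u (by simp)
  rwa [insert_erase_eq_insert, insert_empty_eq] at this

/-- By symmetry, passing to the complement negates the marginal value of `u`. The upper bound from
diminishing returns therefore also serves as a lower bound. -/
theorem IsSubmodular.abs_marginal_le (hf : IsSubmodular f) (hs : IsSymmetricSetFun f)
    (h0 : ∀ S, 0 ≤ f S) (u : Fin n) (S : Finset (Fin n)) : |marginal f u S| ≤ f {u} := by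
  have h₁ := hf.marginal_le u S
  have h₂ := hf.marginal_le u Sᶜ
  have h₃ : marginal f u Sᶜ = -marginal f u S := by
    have e₁ : insert u Sᶜ = (S.erase u)ᶜ := by ext; simp [or_iff_not_imp_left]
    have e₂ : Sᶜ.erase u = (insert u S)ᶜ := by ext; simp
    rw [marginal, marginal, e₁, e₂, hs, hs]
    ring
  have := h0 ∅
  rw [abs_le]
  constructor <;> linarith

/-- Adding the elements of `S` to `R` one at a time gains no more than adding each of them to `R`
alone. The next lemma is the counterpart for removing the elements of `S` from `R`. -/
theorem IsSubmodular.sub_le_sum_union (hf : IsSubmodular f) (R S : Finset (Fin n)) :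
    f (R ∪ S) - f R ≤ ∑ u ∈ S, if u ∈ R then 0 else marginal f u R := by
  induction S using Finset.induction_on with
  | empty => simp
  | insert u S hu ih =>
    rw [Finset.sum_insert hu, Finset.union_insert]
    split_ifs with h
    · rw [Finset.insert_eq_self.2 (by simp [h])]
      linarith
    · have := hf R (R ∪ S) Finset.subset_union_left u (by simp [h, hu])
      rw [marginal, Finset.erase_eq_of_notMem h]
      linarith

theorem IsSubmodular.sum_sdiff_le_sub (hf : IsSubmodular f) (R S : Finset (Fin n)) :
    ∑ u ∈ S, (if u ∈ R then marginal f u R else 0) ≤ f R - f (R \ S) := by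
  induction S using Finset.induction_on with
  | empty => simp
  | insert u S hu ih =>
    rw [Finset.sum_insert hu]
    split_ifs with h
    · have := hf ((R \ S).erase u) (R.erase u) (Finset.erase_subset_erase _ Finset.sdiff_subset)
        u (by simp)
      rw [insert_erase_eq_insert, insert_erase_eq_insert,
        Finset.insert_eq_self.2 (by simp [h, hu] : u ∈ R \ S)] at this
      rw [Finset.insert_eq_self.2 h] at this
      rw [marginal, Finset.sdiff_insert, Finset.insert_eq_self.2 h]
      linarith
    · rw [Finset.sdiff_insert, Finset.erase_eq_of_notMem (s := R \ S) (by simp [h])]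
      linarith

/-- Moving from `x` in the direction `(1 - 2 x) * charVec S` closes the gap between `f S` and
`2 F(x)`. -/
theorem IsSubmodular.le_sum_marginal (hf : IsSubmodular f) (hs : IsSymmetricSetFun f)
    (h0 : ∀ S, 0 ≤ f S) {x : Fin n → ℝ} (hx : ∀ u, 0 ≤ x u ∧ x u ≤ 1) (S : Finset (Fin n)) :
    f S - 2 * multilinearExt f x ≤
      ∑ u ∈ S, (1 - 2 * x u) * multilinearExt (marginal f u) x := by
  -- Write `1 - 2 x_u = (1 - x_u) - x_u`, the probability of `u ∉ R` minus that of `u ∈ R`. The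
  -- marginal value of `u` does not depend on this event, so the product becomes a single
  -- expectation over `R`.
  have h₁ : ∀ u, (1 - 2 * x u) * multilinearExt (marginal f u) x =
      multilinearExt (fun R => (if u ∈ R then 0 else marginal f u R) +
        (-1) * if u ∈ R then marginal f u R else 0) x := by
    intro u
    rw [multilinearExt_split (fun R => _ + _) x u]
    have e₁ : (fun R : Finset (Fin n) => (if u ∈ R.erase u then 0 else marginal f u (R.erase u)) +
        (-1) * if u ∈ R.erase u then marginal f u (R.erase u) else 0) = marginal f u := by
      ext R
      simp [marginal, insert_erase_eq_insert]
    have e₂ : (fun R : Finset (Fin n) => (if u ∈ insert u R then 0 else marginal f u (insert u R)) +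
        (-1) * if u ∈ insert u R then marginal f u (insert u R) else 0) =
        fun R => (-1) * marginal f u R := by
      ext R
      simp [marginal]
    rw [e₁, e₂, multilinearExt_const_mul]
    ring
  have h₂ : f S - 2 * multilinearExt f x = multilinearExt (fun R => f S + (-2) * f R) x := by
    rw [multilinearExt_add, multilinearExt_const, multilinearExt_const_mul]
    ring
  simp only [h₁]
  rw [← multilinearExt_sum, h₂]
  refine multilinearExt_mono hx fun R => ?_
  rw [Finset.sum_add_distrib, ← Finset.mul_sum]
  have h₃ := hf.sub_le_sum_union R S
  have h₄ := hf.sum_sdiff_le_sub R S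
  -- The two sets meet exactly in `S`, and symmetry turns the value of the second into `f (R \ S)`.
  have h₅ := hf.union_add_inter_le (R ∪ S) (R \ S)ᶜ
  have h₆ : (R ∪ S) ∩ (R \ S)ᶜ = S := by ext; simp; tauto
  rw [h₆, hs] at h₅
  have := h0 (R ∪ S ∪ (R \ S)ᶜ)
  linarith

end Submodular

namespace CoinTree

/-! ### Sampling -/

/-- Doubling a threshold and subtracting a coin, `T` times. -/
noncomputable def bits (T : ℕ) (t : ℝ) : CoinTree ℝ :=
  loop (fun _ t => flip fun c => ret (t + t - if c then 1 else 0)) 0 T t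

/-- A 0/1-valued variable whose mean is almost `t`. -/
noncomputable def bernoulli (T : ℕ) (t : ℝ) : CoinTree ℝ :=
  (bits T t).bind fun s => ret (if 0 < s then 1 else 0)

/-- A vector whose entries are obtained one after the other. -/
def fill {n : ℕ} (g : Fin n → CoinTree ℝ) : CoinTree (Fin n → ℝ) :=
  loop (fun i z => if h : i < n then (g ⟨i, h⟩).bind fun v => ret (Function.update z ⟨i, h⟩ v)
    else ret z) 0 n 0

/-- The map `t ↦ 2t - c` with a coin `c` compares `t` with a random binary fraction, digit by digit.
Thresholds outside `(0, 1)` are already decided. From inside `[0, 1]` one of the two values of the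
coin decides, so every further digit halves the error. -/
theorem mean_bits (k : ℕ) : ∀ (i : ℕ) (t : ℝ),
    (t ≤ 0 → (loop (fun _ t => flip fun c => ret (t + t - if c then 1 else 0)) i k t).mean
      (fun s => if 0 < s then 1 else 0) = 0) ∧
    (1 ≤ t → (loop (fun _ t => flip fun c => ret (t + t - if c then 1 else 0)) i k t).mean
      (fun s => if 0 < s then 1 else 0) = 1) ∧
    (0 ≤ t → t ≤ 1 →
      |(loop (fun _ t => flip fun c => ret (t + t - if c then 1 else 0)) i k t).mean
        (fun s => if 0 < s then 1 else 0) - t| ≤ (1 / 2) ^ k) := by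
  induction k with
  | zero =>
    intro i t
    simp only [loop, mean, pow_zero]
    refine ⟨fun h => if_neg h.not_gt, fun h => if_pos (by linarith), fun h₀ h₁ => ?_⟩
    rw [abs_le]
    split_ifs <;> constructor <;> linarith
  | succ k ih =>
    intro i t
    obtain ⟨a₁, a₂, a₃⟩ := ih (i + 1) (t + t - 1)
    obtain ⟨b₁, b₂, b₃⟩ := ih (i + 1) (t + t - 0)
    simp only [loop, mean, bind, if_true, Bool.false_eq_true, if_false]
    refine ⟨fun h => ?_, fun h => ?_, fun h₀ h₁ => ?_⟩
    · rw [a₁ (by linarith), b₁ (by linarith)]; norm_num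
    · rw [a₂ (by linarith), b₂ (by linarith)]; norm_num
    · rw [pow_succ, abs_le]
      rcases le_total t (1 / 2) with h | h
      · rw [a₁ (by linarith)]
        have := abs_le.1 (b₃ (by linarith) (by linarith))
        constructor <;> linarith
      · rw [b₂ (by linarith)]
        have := abs_le.1 (a₃ (by linarith) (by linarith))
        constructor <;> linarith

theorem abs_mean_bernoulli_sub_le (T : ℕ) {t : ℝ} (h₀ : 0 ≤ t) (h₁ : t ≤ 1) :
    |(bernoulli T t).mean (fun v => v) - t| ≤ (1 / 2) ^ T := by
  rw [bernoulli, mean_bind]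
  exact (mean_bits T 0 t).2.2 h₀ h₁

theorem all_bernoulli (T : ℕ) (t : ℝ) : (bernoulli T t).All fun v => v = 0 ∨ v = 1 :=
  (All.of_forall (p := fun _ => True) _ fun _ => trivial).bind fun s _ => by
    simp only [All]
    split_ifs <;> simp

theorem depthLE_bernoulli (T : ℕ) (t : ℝ) : (bernoulli T t).DepthLE T := by
  have : (bits T t).DepthLE (T * 1) :=
    DepthLE.loop (d := 1) (f := fun _ (t : ℝ) => flip fun c => ret (t + t - if c then 1 else 0))
      (fun _ _ _ => trivial) T 0 t
  rw [mul_one] at this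
  exact this.bind (e := 0) fun s => trivial

section Fill

variable {n : ℕ}

theorem all_fill {g : Fin n → CoinTree ℝ} {p : Fin n → ℝ → Prop} (h : ∀ u, (g u).All (p u)) :
    (fill g).All fun z => ∀ u, p u (z u) := by
  have := All.loop (f := fun i z => if h : i < n then
      (g ⟨i, h⟩).bind fun v => ret (Function.update z ⟨i, h⟩ v) else ret z)
    (p := fun i z => ∀ u : Fin n, u.1 < i → p u (z u)) n 0 0 (fun u hu => absurd hu (by omega))
    fun j z _ hj hz => by
      rw [dif_pos (by omega)]
      refine (h _).bind fun v hv u hu => ?_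
      by_cases huj : u = ⟨j, by omega⟩
      · rw [huj, Function.update_self]
        exact hv
      · rw [Function.update_of_ne huj]
        refine hz u ?_
        have : u.1 ≠ j := fun h => huj (Fin.ext h)
        omega
  exact this.mono fun z hz u => hz u (by omega)

theorem depthLE_fill {g : Fin n → CoinTree ℝ} {d : ℕ} (h : ∀ u, (g u).DepthLE d) :
    (fill g).DepthLE (n * d) := by
  refine DepthLE.loop (fun i z => ?_) n 0 0
  split_ifs with hi
  · exact (h _).bind (e := 0) fun _ => trivial
  · trivial

theorem mean_fill_apply (g : Fin n → CoinTree ℝ) (u : Fin n) (ψ : ℝ → ℝ) :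
    (fill g).mean (fun z => ψ (z u)) = (g u).mean ψ := by
  have key : ∀ (k i : ℕ) (z : Fin n → ℝ), i + k = n →
      (loop (fun i z => if h : i < n then
        (g ⟨i, h⟩).bind fun v => ret (Function.update z ⟨i, h⟩ v) else ret z) i k z).mean
          (fun z => ψ (z u)) = if u.1 < i then ψ (z u) else (g u).mean ψ := by
    intro k
    induction k with
    | zero =>
      intro i z hi
      rw [if_pos (by omega)]
      rfl
    | succ k ih =>
      intro i z hi
      rw [loop, mean_bind, dif_pos (by omega), mean_bind]
      simp only [mean, ih (i + 1) _ (by omega : i + 1 + k = n)]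
      by_cases hu : u = ⟨i, by omega⟩
      · subst hu
        simp
      · have : u.1 ≠ i := fun h => hu (Fin.ext h)
        simp only [Function.update_of_ne hu, mean_const]
        exact if_congr (by omega) rfl rfl
  rw [fill, key n 0 0 (by omega), if_neg (by omega)]

/-- A function that is affine in each of several independent variables may be averaged by
substituting their means. -/
theorem mean_fill_multilinearExt (g : Fin n → CoinTree ℝ) (φ : Finset (Fin n) → ℝ) :
    (fill g).mean (multilinearExt φ) = multilinearExt φ fun u => (g u).mean fun v => v := by
  have key : ∀ (k i : ℕ) (z : Fin n → ℝ), i + k = n →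
      (loop (fun i z => if h : i < n then
        (g ⟨i, h⟩).bind fun v => ret (Function.update z ⟨i, h⟩ v) else ret z) i k z).mean
          (multilinearExt φ) =
        multilinearExt φ fun u => if u.1 < i then z u else (g u).mean fun v => v := by
    intro k
    induction k with
    | zero =>
      intro i z hi
      simp only [loop, mean]
      congr 1
      ext u
      rw [if_pos (by omega)]
    | succ k ih =>
      intro i z hi
      have hin : i < n := by omega
      rw [loop, mean_bind, dif_pos hin, mean_bind]
      -- The entries below `i` are already drawn and the others stand at their means. Drawing entry
      -- `i` averages an affine function of it.
      simp only [mean, ih (i + 1) _ (by omega : i + 1 + k = n)]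
      set y : Fin n → ℝ := fun u => if u.1 < i then z u else (g u).mean fun v => v with hy
      have h : ∀ v : ℝ, multilinearExt φ (fun u => if u.1 < i + 1 then
          Function.update z ⟨i, hin⟩ v u else (g u).mean fun v => v) =
          (multilinearExt φ y - y ⟨i, hin⟩ * multilinearExt (marginal φ ⟨i, hin⟩) y) +
            v * multilinearExt (marginal φ ⟨i, hin⟩) y := by
        intro v
        have : (fun u : Fin n => if u.1 < i + 1 then
            Function.update z ⟨i, hin⟩ v u else (g u).mean fun v => v) =
            Function.update y ⟨i, hin⟩ v := by
          ext u
          by_cases hu : u = ⟨i, hin⟩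
          · subst hu
            simp
          · have : u.1 ≠ i := fun h => hu (Fin.ext h)
            simp only [Function.update_of_ne hu, hy]
            exact if_congr (by omega) rfl rfl
        rw [this, multilinearExt_update]
        ring
      simp only [h]
      rw [mean_affine _ _ _ fun v => v]
      have : y ⟨i, hin⟩ = (g ⟨i, hin⟩).mean fun v => v := if_neg (by simp)
      rw [this]
      ring
  rw [fill, key n 0 0 (by omega)]
  simp

theorem mean_fill_set {g : Fin n → CoinTree ℝ} (h : ∀ u, (g u).All fun v => v = 0 ∨ v = 1)
    (φ : Finset (Fin n) → ℝ) :
    (fill g).mean (fun z => φ {v | z v ≠ 0}) =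
      multilinearExt φ fun u => (g u).mean fun v => v := by
  rw [← mean_fill_multilinearExt]
  exact mean_congr ((all_fill h).mono fun z hz => (multilinearExt_indicator φ hz).symm)

end Fill

/-- The second moment of a sum of independent samples around its mean. -/
theorem mean_sum_sq_le {α : Type} (t : CoinTree α) {Z : α → ℝ} {M : ℝ} (hZ : ∀ a, |Z a| ≤ M)
    (c : ℝ) (k : ℕ) : ∀ (i : ℕ) (q : ℝ),
    (loop (fun _ q => t.bind fun z => ret (q + Z z)) i k q).mean (fun r => (r - c) ^ 2) ≤
      (q + k * t.mean Z - c) ^ 2 + k * M ^ 2 := by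
  induction k with
  | zero => intro i q; simp [loop, mean]
  | succ k ih =>
    intro i q
    rw [loop, mean_bind, mean_bind]
    simp only [mean]
    refine (mean_le_mean (All.of_forall _ fun a => ih (i + 1) (q + Z a))).trans ?_
    have h : ∀ a, (q + Z a + k * t.mean Z - c) ^ 2 + k * M ^ 2 ≤
        ((q + k * t.mean Z - c) ^ 2 + (k + 1) * M ^ 2) +
          Z a * (2 * (q + k * t.mean Z - c)) := by
      intro a
      -- Each sample adds at most `M ^ 2` to the second moment; the cross term is linear in `Z a`
      -- and only shifts the mean.
      have := sq_le_sq' (abs_le.1 (hZ a)).1 (abs_le.1 (hZ a)).2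
      nlinarith
    refine (mean_le_mean (All.of_forall _ h)).trans ?_
    rw [mean_affine]
    push_cast
    nlinarith [sq_nonneg (t.mean Z)]

end CoinTree

/-! ### The algorithm -/

namespace SymGreedy

open CoinTree

variable {n : ℕ}

/-- The sum of `T` samples of the marginal value of `u` with respect to a random set. -/
noncomputable def sampleSum (f : Finset (Fin n) → ℝ) (T : ℕ) (x : Fin n → ℝ) (u : Fin n) :
    CoinTree ℝ :=
  loop (fun _ q => (fill fun v => bernoulli T (x v)).bind fun z =>
    ret (q + marginal f u {v | z v ≠ 0})) 0 T 0

open Classical in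
/-- Whether the singleton `u` is feasible. -/
noncomputable def mask (O : (Fin n → ℝ) → (Fin n → ℝ)) (u : Fin n) : ℝ :=
  if O (Pi.single u 1) u < 1 then 0 else 1

noncomputable def weights (f : Finset (Fin n) → ℝ) (O : (Fin n → ℝ) → (Fin n → ℝ)) (T : ℕ)
    (x : Fin n → ℝ) : CoinTree (Fin n → ℝ) :=
  fill fun u => (sampleSum f T x u).bind fun q => ret (q * ((1 - x u - x u) * mask O u))

noncomputable def move (O : (Fin n → ℝ) → (Fin n → ℝ)) (T : ℕ) (x y : Fin n → ℝ) : Fin n → ℝ :=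
  fun u => x u + (1 - x u - x u) * mask O u * y u * (1 / (T : ℝ))

noncomputable def step (f : Finset (Fin n) → ℝ) (O : (Fin n → ℝ) → (Fin n → ℝ)) (T : ℕ)
    (x : Fin n → ℝ) : CoinTree (Fin n → ℝ) :=
  (weights f O T x).bind fun w => ret (move O T x (O w))

/-- `K` steps of measured continuous greedy with step size `1 / T`. -/
noncomputable def greedy (f : Finset (Fin n) → ℝ) (O : (Fin n → ℝ) → (Fin n → ℝ)) (T K : ℕ) :
    CoinTree (Fin n → ℝ) :=
  loop (fun _ x => step f O T x) 0 K 0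

theorem depthLE_greedy (f : Finset (Fin n) → ℝ) (O : (Fin n → ℝ) → (Fin n → ℝ)) (T K : ℕ) :
    (greedy f O T K).DepthLE (K * (n * (T * (n * T)))) := by
  refine DepthLE.loop (fun _ x => ?_) K 0 0
  refine DepthLE.bind (e := 0) (depthLE_fill fun u => ?_) fun _ => trivial
  refine DepthLE.bind (e := 0) (DepthLE.loop (fun _ q => ?_) T 0 0) fun _ => trivial
  exact DepthLE.bind (e := 0) (depthLE_fill fun v => depthLE_bernoulli T _) fun _ => trivial

theorem mask_eq (O : (Fin n → ℝ) → (Fin n → ℝ)) (u : Fin n) : mask O u = 0 ∨ mask O u = 1 := by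
  unfold mask
  split_ifs <;> simp

/-! ### Feasibility of the iterates -/

section Feasible

variable {O : (Fin n → ℝ) → (Fin n → ℝ)} {P : Set (Fin n → ℝ)}

theorem zero_mem (hO : IsLinOptOracle P O) (hd : IsDownClosed P)
    (hP : P ⊆ {x | ∀ u, 0 ≤ x u ∧ x u ≤ 1}) : (0 : Fin n → ℝ) ∈ P :=
  hd _ (hO 0).1 0 le_rfl fun u => (hP (hO 0).1 u).1

/-- If the answer to the unit weight at `u` reaches `1` there, it dominates the singleton. Thus
unmasked elements satisfy `f {u} ≤ f(OPT)`, while the next lemma shows that masking never removes an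
element of a feasible set. -/
theorem charVec_singleton_mem (hO : IsLinOptOracle P O) (hd : IsDownClosed P)
    (hP : P ⊆ {x | ∀ u, 0 ≤ x u ∧ x u ≤ 1}) {u : Fin n} (h : mask O u ≠ 0) :
    charVec {u} ∈ P := by
  have h₁ : ¬ O (Pi.single u 1) u < 1 := fun hlt => h (if_pos hlt)
  have h₂ := hO (Pi.single u 1)
  refine hd _ h₂.1 _ (fun v => ?_) fun v => ?_
  · simp only [charVec, Pi.zero_apply]
    split_ifs <;> norm_num
  · simp only [charVec, Finset.mem_singleton]
    split_ifs with hv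
    · subst hv
      exact not_lt.1 h₁
    · exact (hP h₂.1 v).1

theorem mask_eq_one (hO : IsLinOptOracle P O) (hd : IsDownClosed P) {S : Finset (Fin n)}
    (hS : charVec S ∈ P) {u : Fin n} (hu : u ∈ S) : mask O u = 1 := by
  have h : charVec {u} ∈ P := by
    refine hd _ hS _ (fun v => ?_) fun v => ?_
    · simp only [charVec, Pi.zero_apply]
      split_ifs <;> norm_num
    · simp only [charVec, Finset.mem_singleton]
      split_ifs with h₁ h₂ h₂
      · exact le_rfl
      · exact absurd (h₁ ▸ hu) h₂
      · exact zero_le_one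
      · exact le_rfl
  have := (hO (Pi.single u 1)).2 _ h
  simp only [Pi.single_apply, ite_mul, one_mul, zero_mul, Finset.sum_ite_eq', Finset.mem_univ,
    if_true, charVec, Finset.mem_singleton] at this
  exact if_neg this.not_gt

theorem move_mem_Icc {T : ℕ} (hT : 2 ≤ T) {x y : Fin n → ℝ} (hy : ∀ u, 0 ≤ y u ∧ y u ≤ 1)
    (hx : ∀ u, 0 ≤ x u ∧ x u ≤ 1 / 2) (u : Fin n) :
    0 ≤ move O T x y u ∧ move O T x y u ≤ 1 / 2 := by
  have hT' : (1 : ℝ) / T ≤ 1 / 2 := one_div_le_one_div_of_le two_pos (by exact_mod_cast hT)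
  have hT₀ : (0 : ℝ) ≤ 1 / T := by positivity
  -- A step maps `x` to `x + (1 - 2x) a`, whose distance to `1/2` is `(1 - 2a)(1/2 - x)`; so `0 ≤ a
  -- ≤ 1/2` keeps it in `[0, 1/2]`.
  have hm : 0 ≤ mask O u * y u * (1 / (T : ℝ)) ∧ mask O u * y u * (1 / (T : ℝ)) ≤ 1 / 2 := by
    rcases mask_eq O u with h | h <;> rw [h]
    · norm_num
    · rw [one_mul]
      exact ⟨mul_nonneg (hy u).1 hT₀, by nlinarith [hy u]⟩
  have h₁ := hx u
  simp only [move]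
  rw [mul_assoc, mul_assoc, ← mul_assoc (mask O u)]
  constructor <;> nlinarith

theorem all_greedy (hO : IsLinOptOracle P O) (hd : IsDownClosed P) (hc : Convex ℝ P)
    (hP : P ⊆ {x | ∀ u, 0 ≤ x u ∧ x u ≤ 1}) (f : Finset (Fin n) → ℝ) {T : ℕ} (hT : 2 ≤ T)
    (K : ℕ) : (greedy f O T K).All fun x =>
      (∀ u, 0 ≤ x u ∧ x u ≤ 1 / 2) ∧ ∃ y ∈ P, x ≤ ((K : ℝ) / T) • y := by
  have := All.loop (f := fun _ x => step f O T x) (p := fun i x =>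
      (∀ u, 0 ≤ x u ∧ x u ≤ 1 / 2) ∧ ∃ y ∈ P, x ≤ ((i : ℝ) / T) • y) K 0 0
    ⟨fun u => by norm_num, 0, zero_mem hO hd hP, by simp⟩ ?_
  · unfold greedy
    simpa only [zero_add] using this
  · rintro i x - - ⟨hx, y, hy, hxy⟩
    refine (All.of_forall (p := fun _ => True) _ fun _ => trivial).bind fun w _ => ?_
    have hw := (hO w).1
    -- The dominating point is the running average of the oracle's answers.
    refine ⟨move_mem_Icc hT (hP hw) hx, ((i : ℝ) / (i + 1)) • y + ((1 : ℝ) / (i + 1)) • O w,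
      hc hy hw (by positivity) (by positivity) (by field_simp), fun u => ?_⟩
    have h₁ := hxy u
    have h₂ := hP hw u
    have h₃ := hx u
    have hT₀ : (0 : ℝ) ≤ 1 / T := by positivity
    have h₄ : (1 - x u - x u) * mask O u * O w u * (1 / (T : ℝ)) ≤ O w u * (1 / (T : ℝ)) := by
      refine mul_le_mul_of_nonneg_right (mul_le_of_le_one_left h₂.1 ?_) hT₀
      rcases mask_eq O u with h | h <;> rw [h] <;> linarith
    simp only [Pi.smul_apply, Pi.add_apply, smul_eq_mul, move] at h₁ ⊢
    have h₅ : ((i + 1 : ℕ) : ℝ) / T * ((i : ℝ) / (i + 1) * y u + 1 / (i + 1) * O w u) =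
        (i : ℝ) / T * y u + O w u * (1 / T) := by
      push_cast
      field_simp
    rw [h₅]
    linarith

end Feasible

/-! ### Expected progress of the greedy steps -/

section Analysis

variable {f : Finset (Fin n) → ℝ} {O : (Fin n → ℝ) → (Fin n → ℝ)} {P : Set (Fin n → ℝ)}

/-- Two errors add up. The standard deviation of the sum is at most `√T * M = L * M`. The bias of
the coins moves the mean of one sample by at most `2 * n * M / 2 ^ T`, and `T / 2 ^ T ≤ 1`. -/
theorem mean_abs_sampleSum_le {L T : ℕ} (hLT : T = L ^ 2) {x : Fin n → ℝ}
    (hx : ∀ u, 0 ≤ x u ∧ x u ≤ 1) {u : Fin n} {M : ℝ} (hM : ∀ S, |marginal f u S| ≤ M) :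
    (sampleSum f T x u).mean (fun q => |q - T * multilinearExt (marginal f u) x|) ≤
      (L + 2 * n) * M := by
  have hM0 : 0 ≤ M := (abs_nonneg _).trans (hM ∅)
  set p : Fin n → ℝ := fun v => (bernoulli T (x v)).mean fun s => s with hp
  have hp01 : ∀ v, 0 ≤ p v ∧ p v ≤ 1 := fun v => by
    constructor
    · rw [← mean_const (bernoulli T (x v)) 0]
      exact mean_le_mean ((all_bernoulli T (x v)).mono fun a ha => by
        rcases ha with rfl | rfl <;> norm_num)
    · rw [← mean_const (bernoulli T (x v)) 1]
      exact mean_le_mean ((all_bernoulli T (x v)).mono fun a ha => by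
        rcases ha with rfl | rfl <;> norm_num)
  set μ := multilinearExt (marginal f u) p with hμ
  have h₁ : (sampleSum f T x u).mean (fun q => |q - T * μ|) ≤ L * M := by
    refine abs_le_of_sq_le_sq' ?_ (by positivity) |>.2
    refine (mean_sq_le _ _).trans ?_
    simp only [sq_abs]
    have := mean_sum_sq_le (fill fun v => bernoulli T (x v))
      (Z := fun z => marginal f u {v | z v ≠ 0}) (fun z => hM _) (T * μ) T 0 0
    rw [mean_fill_set (fun v => all_bernoulli T _)] at this
    refine this.trans (le_of_eq ?_)
    rw [← hμ]
    subst hLT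
    push_cast
    ring
  have h₂ : |μ - multilinearExt (marginal f u) x| ≤ 2 * M * (n * (1 / 2) ^ T) := by
    refine (abs_multilinearExt_sub_le_of_abs_le hx hp01 hM).trans ?_
    refine mul_le_mul_of_nonneg_left ?_ (by positivity)
    refine (Finset.sum_le_card_nsmul _ _ _ fun v _ =>
      abs_mean_bernoulli_sub_le T (hx v).1 (hx v).2).trans ?_
    simp
  have h₃ : (T : ℝ) * (1 / 2) ^ T ≤ 1 := by
    rw [one_div, inv_pow, ← div_eq_mul_inv, div_le_one (by positivity)]
    exact_mod_cast Nat.lt_two_pow_self.le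
  have h₄ : T * |μ - multilinearExt (marginal f u) x| ≤ 2 * n * M := by
    calc T * |μ - multilinearExt (marginal f u) x|
        ≤ T * (2 * M * (n * (1 / 2) ^ T)) := mul_le_mul_of_nonneg_left h₂ (by positivity)
      _ = 2 * n * M * (T * (1 / 2) ^ T) := by ring
      _ ≤ 2 * n * M * 1 := mul_le_mul_of_nonneg_left h₃ (by positivity)
      _ = 2 * n * M := mul_one _
  calc (sampleSum f T x u).mean (fun q => |q - T * multilinearExt (marginal f u) x|)
      ≤ (sampleSum f T x u).mean (fun q => |q - T * μ| +
          T * |μ - multilinearExt (marginal f u) x|) := by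
        refine mean_le_mean (All.of_forall _ fun q => ?_)
        rw [← abs_of_nonneg (Nat.cast_nonneg T : (0 : ℝ) ≤ T), ← abs_mul,
          abs_of_nonneg (Nat.cast_nonneg T : (0 : ℝ) ≤ T)]
        refine le_trans (le_of_eq ?_) (abs_add_le _ _)
        congr 1
        ring
    _ ≤ L * M + 2 * n * M := by
        rw [mean_add, mean_const]
        exact add_le_add h₁ h₄
    _ = (L + 2 * n) * M := by ring

/-- The progress of one step, given how far the weights are from their ideal values. -/
theorem move_progress (h0 : ∀ S, 0 ≤ f S) (hf : IsSubmodular f) (hs : IsSymmetricSetFun f)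
    (hP : P ⊆ {x | ∀ u, 0 ≤ x u ∧ x u ≤ 1}) (hd : IsDownClosed P) (hO : IsLinOptOracle P O)
    {S : Finset (Fin n)} (hS : IsIntegerOptimum f P S) {T : ℕ} (hT : 2 ≤ T) {x : Fin n → ℝ}
    (hx : ∀ u, 0 ≤ x u ∧ x u ≤ 1 / 2) (w : Fin n → ℝ) :
    1 / (T : ℝ) * (f S - 2 * multilinearExt f x) -
        (1 / (T : ℝ)) ^ 2 * ∑ u, |w u - T * multilinearExt (marginal f u) x *
          ((1 - x u - x u) * mask O u)| - 2 * n ^ 2 * (1 / (T : ℝ)) ^ 2 * f S ≤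
      multilinearExt f (move O T x (O w)) - multilinearExt f x := by
  have hT0 : (0 : ℝ) < T := by exact_mod_cast (by omega : 0 < T)
  set δ : ℝ := 1 / T with hδ
  have hδ0 : 0 < δ := by positivity
  have hTδ : T * δ = 1 := by rw [hδ]; field_simp
  have hM0 := h0 S
  have hx1 : ∀ u, 0 ≤ x u ∧ x u ≤ 1 := fun u => ⟨(hx u).1, by linarith [(hx u).2]⟩
  set y := O w with hy
  have hyP := hP (hO w).1
  set x' := move O T x y with hx'
  have hx'1 : ∀ u, 0 ≤ x' u ∧ x' u ≤ 1 := fun u => by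
    have := move_mem_Icc (O := O) hT hyP hx u
    exact ⟨this.1, by linarith [this.2]⟩
  set c : Fin n → ℝ := fun u => (1 - x u - x u) * mask O u with hc
  have hc01 : ∀ u, 0 ≤ c u ∧ c u ≤ 1 := fun u => by
    have := hx u
    simp only [hc]
    rcases mask_eq O u with h | h <;> rw [h] <;> constructor <;> linarith
  have hdiff : ∀ u, x' u - x u = c u * y u * δ := fun u => by
    simp only [hx', move, hc, hδ]
    ring
  have hdiff' : ∀ u, |x' u - x u| ≤ δ := fun u => by
    have h₁ := hc01 u
    have h₂ := hyP u
    rw [hdiff, abs_of_nonneg (mul_nonneg (mul_nonneg h₁.1 h₂.1) hδ0.le)]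
    exact mul_le_of_le_one_left hδ0.le (mul_le_one₀ h₁.2 h₂.1 h₂.2)
  set D : Fin n → ℝ := fun u => multilinearExt (marginal f u) x with hD
  have hsum : ∀ z : Fin n → ℝ, (∀ v, z v = x v ∨ z v = x' v) → ∑ v, |z v - x v| ≤ n * δ := by
    intro z hz
    refine (Finset.sum_le_card_nsmul _ _ δ fun v _ => ?_).trans (by simp)
    rcases hz v with h | h <;> rw [h]
    · simpa using hδ0.le
    · exact hdiff' v
  -- Second-order error: the coordinates move by at most `n * δ` in total, which changes every
  -- relevant derivative by at most `2 * f S * (n * δ)`. Masked coordinates do not move, so their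
  -- possibly huge marginals play no role.
  have h₁ : |multilinearExt f x' - multilinearExt f x - ∑ u, (x' u - x u) * D u| ≤
      2 * n ^ 2 * δ ^ 2 * f S := by
    refine abs_multilinearExt_sub_le hx1 hx'1 D (fun _ => 2 * f S * (n * δ))
      (fun u z hz hzx hne => ?_) ?_
    · have hm : mask O u ≠ 0 := fun h => hne (by
        have := hdiff u
        simp only [hc, h, mul_zero, zero_mul] at this
        linarith)
      have hu : f {u} ≤ f S := hS.2 _ (charVec_singleton_mem hO hd hP hm)
      refine (abs_multilinearExt_sub_le_of_abs_le hx1 hz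
        fun R => (hf.abs_marginal_le hs h0 u R).trans hu).trans ?_
      exact mul_le_mul_of_nonneg_left (hsum z hzx) (by positivity)
    · rw [← Finset.sum_mul]
      calc (∑ u, |x' u - x u|) * (2 * f S * (n * δ))
          ≤ (n * δ) * (2 * f S * (n * δ)) :=
            mul_le_mul_of_nonneg_right (hsum x' fun v => Or.inr rfl) (by positivity)
        _ = 2 * n ^ 2 * δ ^ 2 * f S := by ring
  have h₂ : f S - 2 * multilinearExt f x ≤ ∑ u, c u * D u * charVec S u := by
    refine (hf.le_sum_marginal hs h0 hx1 S).trans (le_of_eq ?_)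
    simp only [charVec, mul_ite, mul_one, mul_zero, Finset.sum_ite_mem, Finset.univ_inter]
    refine Finset.sum_congr rfl fun u hu => ?_
    simp only [hc, mask_eq_one hO hd hS.1 hu, hD]
    ring
  have h₃ := (hO w).2 _ hS.1
  rw [← hy] at h₃
  -- The oracle is optimal for the weights `w`, not for `T * c * D`. As `charVec S - y` has entries
  -- in `[-1, 1]`, replacing one by the other costs at most the sum of the absolute errors. The
  -- factor `T` appears because samples are summed, not averaged.
  have h₄ : ∑ u, (T * (c u * D u * charVec S u) - |w u - T * D u * c u| - T * (c u * D u * y u)) ≤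
      ∑ u, (w u * charVec S u - w u * y u) := by
    refine Finset.sum_le_sum fun u _ => ?_
    have hcv : 0 ≤ charVec S u ∧ charVec S u ≤ 1 := by
      unfold charVec
      split_ifs <;> norm_num
    have hyu := hyP u
    have h₅ : |(w u - T * D u * c u) * (charVec S u - y u)| ≤ |w u - T * D u * c u| := by
      rw [abs_mul]
      refine mul_le_of_le_one_right (abs_nonneg _) (abs_le.2 ⟨?_, ?_⟩) <;> linarith
    have := (abs_le.1 h₅).1
    nlinarith
  simp only [Finset.sum_sub_distrib, ← Finset.mul_sum] at h₄
  have h₅ : ∑ u, (x' u - x u) * D u = δ * ∑ u, c u * D u * y u := by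
    rw [Finset.mul_sum]
    refine Finset.sum_congr rfl fun u _ => ?_
    rw [hdiff]
    ring
  have h₆ : f S - 2 * multilinearExt f x - δ * ∑ u, |w u - T * D u * c u| ≤
      ∑ u, c u * D u * y u := by
    have : T * (∑ u, c u * D u * charVec S u) - ∑ u, |w u - T * D u * c u| ≤
        T * ∑ u, c u * D u * y u := by linarith
    have h := mul_le_mul_of_nonneg_left this hδ0.le
    have e : ∀ a : ℝ, δ * (T * a) = a := fun a => by rw [← mul_assoc, mul_comm δ, hTδ, one_mul]
    rw [mul_sub, e, e] at h
    linarith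
  have h₇ := mul_le_mul_of_nonneg_left h₆ hδ0.le
  rw [h₅] at h₁
  have h₈ := (abs_le.1 h₁).1
  nlinarith

/-- A step contracts the gap `f S / 2 - F` by `1 - 2 / T` up to an error. Subtracting a target `A`
that shrinks at the same rate preserves this, and taking positive parts prevents lucky runs from
compensating for bad ones, as Markov's inequality requires. -/
theorem mean_step_le (h0 : ∀ S, 0 ≤ f S) (hf : IsSubmodular f) (hs : IsSymmetricSetFun f)
    (hP : P ⊆ {x | ∀ u, 0 ≤ x u ∧ x u ≤ 1}) (hd : IsDownClosed P) (hO : IsLinOptOracle P O)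
    {S : Finset (Fin n)} (hS : IsIntegerOptimum f P S) {L T : ℕ} (hLT : T = L ^ 2) (hT : 2 ≤ T)
    {x : Fin n → ℝ} (hx : ∀ u, 0 ≤ x u ∧ x u ≤ 1 / 2) (A : ℝ) :
    (step f O T x).mean (fun x' =>
        max 0 (f S / 2 - multilinearExt f x' - (1 - 2 / T) * A)) ≤
      max 0 (f S / 2 - multilinearExt f x - A) +
        (1 / (T : ℝ)) ^ 2 * (n * L + 4 * n ^ 2) * f S := by
  have hT2 : (2 : ℝ) ≤ T := by exact_mod_cast hT
  have hq : (0 : ℝ) ≤ 1 - 2 / T ∧ 1 - 2 / (T : ℝ) ≤ 1 := by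
    constructor
    · rw [sub_nonneg, div_le_one (by linarith)]
      exact hT2
    · rw [sub_le_self_iff]
      positivity
  have hx1 : ∀ u, 0 ≤ x u ∧ x u ≤ 1 := fun u => ⟨(hx u).1, by linarith [(hx u).2]⟩
  have hM0 := h0 S
  set δ : ℝ := 1 / T with hδ
  have hδ0 : 0 ≤ δ := by positivity
  have h2δ : 2 / (T : ℝ) = 2 * δ := by rw [hδ]; ring
  rw [h2δ] at hq ⊢
  rw [step, mean_bind]
  simp only [mean]
  set g := f S / 2 - multilinearExt f x - A with hg
  set Err : Fin n → (Fin n → ℝ) → ℝ := fun u w =>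
    |w u - T * multilinearExt (marginal f u) x * ((1 - x u - x u) * mask O u)| with hErr
  have h₁ : ∀ w, max 0 (f S / 2 - multilinearExt f (move O T x (O w)) - (1 - 2 * δ) * A) ≤
      (max 0 g + 2 * n ^ 2 * δ ^ 2 * f S) + δ ^ 2 * ∑ u, Err u w := by
    intro w
    have h₂ := move_progress h0 hf hs hP hd hO hS hT hx w
    have h₃ : (0 : ℝ) ≤ δ ^ 2 * ∑ u, Err u w :=
      mul_nonneg (by positivity) (Finset.sum_nonneg fun u _ => abs_nonneg _)
    have h₄ : (0 : ℝ) ≤ 2 * n ^ 2 * δ ^ 2 * f S := by positivity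
    refine max_le (by linarith [le_max_left 0 g]) ?_
    have h₅ : (1 - 2 * δ) * g ≤ max 0 g :=
      (mul_le_mul_of_nonneg_left (le_max_right 0 g) hq.1).trans
        (mul_le_of_le_one_left (le_max_left 0 g) hq.2)
    rw [← hδ] at h₂
    simp only [hg] at h₅ ⊢
    linarith
  have h₂ : ∀ u, (weights f O T x).mean (Err u) ≤ (L + 2 * n) * f S := by
    intro u
    have : (weights f O T x).mean (Err u) = (sampleSum f T x u).mean (fun q =>
        |q * ((1 - x u - x u) * mask O u) -
          T * multilinearExt (marginal f u) x * ((1 - x u - x u) * mask O u)|) := by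
      rw [weights, hErr, mean_fill_apply _ u fun v =>
        |v - T * multilinearExt (marginal f u) x * ((1 - x u - x u) * mask O u)|, mean_bind]
      rfl
    rw [this]
    simp only [← sub_mul, abs_mul]
    rcases mask_eq O u with h | h
    · simp only [h, abs_zero, mul_zero, mean_const]
      positivity
    · have hu : f {u} ≤ f S :=
        hS.2 _ (charVec_singleton_mem hO hd hP (by rw [h]; exact one_ne_zero))
      refine le_trans (mean_le_mean (All.of_forall _ fun q => ?_)) (mean_abs_sampleSum_le hLT hx1
        fun R => (hf.abs_marginal_le hs h0 u R).trans hu)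
      rw [h, abs_one, mul_one]
      have := hx u
      exact mul_le_of_le_one_right (abs_nonneg _) (abs_le.2 ⟨by linarith, by linarith⟩)
  refine (mean_le_mean (All.of_forall _ h₁)).trans ?_
  rw [mean_add, mean_const, mean_const_mul, mean_sum]
  have h₃ := Finset.sum_le_card_nsmul Finset.univ _ _ fun u _ => h₂ u
  rw [Finset.card_univ, Fintype.card_fin, nsmul_eq_mul] at h₃
  -- The weights contribute `n * (L + 2 * n)` and the second-order error `2 * n ^ 2`, together `n *
  -- L + 4 * n ^ 2`.
  have h₄ := mul_le_mul_of_nonneg_left h₃ (sq_nonneg δ)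
  nlinarith

theorem mean_loop_step_le (h0 : ∀ S, 0 ≤ f S) (hf : IsSubmodular f) (hs : IsSymmetricSetFun f)
    (hP : P ⊆ {x | ∀ u, 0 ≤ x u ∧ x u ≤ 1}) (hd : IsDownClosed P) (hO : IsLinOptOracle P O)
    {S : Finset (Fin n)} (hS : IsIntegerOptimum f P S) {L T : ℕ} (hLT : T = L ^ 2) (hT : 2 ≤ T)
    (k : ℕ) : ∀ (i : ℕ) (x : Fin n → ℝ) (A : ℝ), (∀ u, 0 ≤ x u ∧ x u ≤ 1 / 2) →
    (loop (fun _ x => step f O T x) i k x).mean (fun x' =>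
        max 0 (f S / 2 - multilinearExt f x' - (1 - 2 / T) ^ k * A)) ≤
      max 0 (f S / 2 - multilinearExt f x - A) +
        k * ((1 / (T : ℝ)) ^ 2 * (n * L + 4 * n ^ 2) * f S) := by
  induction k with
  | zero => intro i x A _; simp [loop, mean]
  | succ k ih =>
    intro i x A hx
    rw [loop, mean_bind]
    have h₁ : (step f O T x).All fun x' => ∀ u, 0 ≤ x' u ∧ x' u ≤ 1 / 2 :=
      (All.of_forall (p := fun _ => True) _ fun _ => trivial).bind fun w _ =>
        move_mem_Icc hT (hP (hO w).1) hx
    have h₂ := mean_le_mean (h₁.mono fun x' hx' => ih (i + 1) x' ((1 - 2 / T) * A) hx')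
    rw [mean_add, mean_const] at h₂
    have h₃ := mean_step_le h0 hf hs hP hd hO hS hLT hT hx A
    have e : (1 - 2 / (T : ℝ)) ^ (k + 1) * A = (1 - 2 / T) ^ k * ((1 - 2 / T) * A) := by ring
    rw [e]
    push_cast
    linarith

/-- In expectation, the output falls only slightly short of `(1 - (1 - 2 / T) ^ K) / 2` times the
optimum. -/
theorem mean_greedy_le (h0 : ∀ S, 0 ≤ f S) (hf : IsSubmodular f) (hs : IsSymmetricSetFun f)
    (hP : P ⊆ {x | ∀ u, 0 ≤ x u ∧ x u ≤ 1}) (hd : IsDownClosed P) (hO : IsLinOptOracle P O)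
    {S : Finset (Fin n)} (hS : IsIntegerOptimum f P S) {L T : ℕ} (hLT : T = L ^ 2) (hT : 2 ≤ T)
    (K : ℕ) : (greedy f O T K).mean (fun x =>
        max 0 ((1 - (1 - 2 / T) ^ K) / 2 * f S - multilinearExt f x)) ≤
      K * ((1 / (T : ℝ)) ^ 2 * (n * L + 4 * n ^ 2) * f S) := by
  -- With this initial target the shortfall at `x = 0` is `max 0 (-F(0)) = 0`.
  have h₁ := mean_loop_step_le h0 hf hs hP hd hO hS hLT hT K 0 0 (f S / 2)
    fun u => ⟨le_rfl, by norm_num⟩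
  have h₂ : 0 ≤ multilinearExt f (0 : Fin n → ℝ) :=
    multilinearExt_nonneg (fun u => ⟨le_rfl, zero_le_one⟩) h0
  rw [max_eq_left (by linarith), zero_add] at h₁
  refine le_trans (le_of_eq ?_) h₁
  unfold greedy
  congr 1
  ext x
  congr 1
  ring

end Analysis

end SymGreedy

/-! ### Reasoning about programs -/

namespace RealRAM

open CoinTree

variable {α β : Type} {n : ℕ} {E : Env n}

/-- With enough coins on the tape, `p` halts within `τ` steps, uses the same coins as the
computation `t`, and establishes `Q` for the outcome of `t`. -/
def Sim (E : Env n) (p : Prog) (s : State) (t : CoinTree α) (τ : ℕ) (Q : α → State → Prop) : Prop :=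
  ∀ a l, t.run s.tape = some (a, l) → ∃ s' j, Exec E p s s' j ∧ j ≤ τ ∧ s'.tape = l ∧ Q a s'

theorem Sim.mono {p : Prog} {s : State} {t : CoinTree α} {τ τ' : ℕ} {Q Q' : α → State → Prop}
    (h : Sim E p s t τ Q) (hτ : τ ≤ τ') (hQ : ∀ a s', Q a s' → Q' a s') : Sim E p s t τ' Q' := by
  intro a l hr
  obtain ⟨s', j, h₁, h₂, h₃, h₄⟩ := h a l hr
  exact ⟨s', j, h₁, h₂.trans hτ, h₃, hQ a s' h₄⟩

theorem Sim.seq {p q : Prog} {s : State} {t : CoinTree α} {g : α → CoinTree β} {τ τ' : ℕ}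
    {R : α → State → Prop} {Q : β → State → Prop} (h : Sim E p s t τ R)
    (h' : ∀ a s', R a s' → Sim E q s' (g a) τ' Q) : Sim E (.seq p q) s (t.bind g) (τ + τ') Q := by
  intro b l hr
  rw [run_bind] at hr
  obtain ⟨⟨a, l₁⟩, hr₁, hr₂⟩ := Option.bind_eq_some_iff.1 hr
  obtain ⟨s₁, j₁, e₁, c₁, rfl, q₁⟩ := h a l₁ hr₁
  obtain ⟨s₂, j₂, e₂, c₂, t₂, q₂⟩ := h' a s₁ q₁ b l hr₂
  exact ⟨s₂, j₁ + j₂, e₁.seq e₂, by omega, t₂, q₂⟩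

/-- The rule for `seq` when the first program tosses no coins. -/
theorem Sim.seqRet {p q : Prog} {s : State} {t : CoinTree β} {τ τ' : ℕ}
    {R : State → Prop} {Q : β → State → Prop} (h : Sim E p s (ret ()) τ fun _ => R)
    (h' : ∀ s', R s' → Sim E q s' t τ' Q) : Sim E (.seq p q) s t (τ + τ') Q :=
  Sim.seq (t := ret ()) (g := fun _ => t) h fun _ => h'

theorem Sim.coin {s : State} {d : ℕ} {Q : Bool → State → Prop}
    (h : ∀ c l, Q c (({ s with tape := l } : State).setMem d (if c then 1 else 0))) :
    Sim E (.coin d) s (flip fun c => ret c) 1 Q := by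
  intro a l hr
  cases hs : s.tape with
  | nil => rw [hs] at hr; cases hr
  | cons c l' =>
    rw [hs] at hr
    cases hr
    exact ⟨_, _, Exec.coin s d a l hs, le_rfl, rfl, h a l⟩

/-- The rule for loops. -/
theorem Sim.whileLoop {b : Test} {p : Prog} {f : ℕ → α → CoinTree α} {k τ : ℕ}
    (Inv : ℕ → α → State → Prop)
    (hstep : ∀ i a s, i < k → Inv i a s → b.holds s ∧ Sim E p s (f i a) τ (Inv (i + 1)))
    (hend : ∀ a s, Inv k a s → ¬ b.holds s) {a : α} {s : State} (h : Inv 0 a s) :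
    Sim E (.while b p) s (loop f 0 k a) (k * (τ + 1) + 1) (Inv k) := by
  have key : ∀ j i a s, i + j = k → Inv i a s →
      Sim E (.while b p) s (loop f i j a) (j * (τ + 1) + 1) (Inv k) := by
    intro j
    induction j with
    | zero =>
      intro i a s hi hI a' l hr
      cases hr
      obtain rfl : i = k := by omega
      exact ⟨s, 1, Exec.whileFalse (hend a s hI), by omega, rfl, hI⟩
    | succ j ih =>
      intro i a s hi hI a' l hr
      obtain ⟨hb, hs⟩ := hstep i a s (by omega) hI
      rw [loop, run_bind] at hr
      obtain ⟨⟨a₁, l₁⟩, hr₁, hr₂⟩ := Option.bind_eq_some_iff.1 hr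
      obtain ⟨s₁, j₁, e₁, c₁, rfl, q₁⟩ := hs a₁ l₁ hr₁
      obtain ⟨s₂, j₂, e₂, c₂, t₂, q₂⟩ := ih (i + 1) a₁ s₁ (by omega) q₁ a' l hr₂
      refine ⟨s₂, _, Exec.whileTrue hb e₁ e₂, ?_, t₂, q₂⟩
      rw [Nat.succ_mul]
      omega
  exact key k 0 a s (by omega) h

/-- The rule for loops that toss no coins. -/
theorem Sim.whileRet {b : Test} {p : Prog} {k τ : ℕ} (Inv : ℕ → State → Prop)
    (hstep : ∀ i s, i < k → Inv i s → b.holds s ∧ Sim E p s (ret ()) τ fun _ => Inv (i + 1))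
    (hend : ∀ s, Inv k s → ¬ b.holds s) {s : State} (h : Inv 0 s) :
    Sim E (.while b p) s (ret ()) (k * (τ + 1) + 1) fun _ => Inv k := by
  have := Sim.whileLoop (f := fun _ (_ : Unit) => ret ()) (fun i _ => Inv i)
    (fun i _ s => hstep i s) (fun _ s => hend s) (a := ()) h
  have e : ∀ k i, loop (fun _ (_ : Unit) => ret ()) i k () = ret () := by
    intro k
    induction k with
    | zero => exact fun i => rfl
    | succ k ih => exact fun i => ih (i + 1)
  rwa [e] at this

/-! Straight-line programs -/

def block : List Prog → Prog
  | [] => .skip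
  | p :: ps => .seq p (block ps)

def Straight : Prog → Prop
  | .coin _ => False
  | .while _ _ => False
  | .seq p q => Straight p ∧ Straight q
  | .ite _ p q => Straight p ∧ Straight q
  | _ => True

/-- Only an upper bound: both branches of a conditional are counted. -/
def cost (n : ℕ) : Prog → ℕ
  | .value _ _ => n + 1
  | .linOpt _ _ => n + 1
  | .seq p q => cost n p + cost n q
  | .ite _ p q => cost n p + cost n q + 1
  | _ => 1

open Classical in
/-- The final state of a straight-line program. -/
noncomputable def final (E : Env n) : Prog → State → State
  | .skip, s => s
  | .regConst d k, s => s.setReg d k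
  | .regSize d, s => s.setReg d n
  | .regAdd d a b, s => s.setReg d (s.reg a + s.reg b)
  | .regSub d a b, s => s.setReg d (s.reg a - s.reg b)
  | .memConst d q, s => s.setMem d q
  | .memParam d, s => s.setMem d E.param
  | .memAdd d a b, s => s.setMem d (s.get a + s.get b)
  | .memSub d a b, s => s.setMem d (s.get a - s.get b)
  | .memMul d a b, s => s.setMem d (s.get a * s.get b)
  | .memDiv d a b, s => s.setMem d (s.get a / s.get b)
  | .coin _, s => s
  | .value d a, s => s.setMem d (E.value (s.set n (s.reg a)))
  | .linOpt d a, s => s.setVec (s.reg d) (E.linOpt (s.vec n (s.reg a)))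
  | .seq p q, s => final E q (final E p s)
  | .ite b p q, s => if b.holds s then final E p s else final E q s
  | .while _ _, s => s

theorem Straight.exec {p : Prog} (hp : Straight p) (s : State) :
    ∃ j, Exec E p s (final E p s) j ∧ j ≤ cost n p ∧ (final E p s).tape = s.tape := by
  induction p generalizing s with
  | seq p q ihp ihq =>
    obtain ⟨j, h₁, h₂, h₃⟩ := ihp hp.1 s
    obtain ⟨j', h₁', h₂', h₃'⟩ := ihq hp.2 (final E p s)
    exact ⟨_, h₁.seq h₁', Nat.add_le_add h₂ h₂', h₃'.trans h₃⟩
  | ite b p q ihp ihq =>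
    by_cases hb : b.holds s
    · obtain ⟨j, h₁, h₂, h₃⟩ := ihp hp.1 s
      simp only [final, if_pos hb, cost]
      exact ⟨_, Exec.iteTrue hb h₁, by omega, h₃⟩
    · obtain ⟨j, h₁, h₂, h₃⟩ := ihq hp.2 s
      simp only [final, if_neg hb, cost]
      exact ⟨_, Exec.iteFalse hb h₁, by omega, h₃⟩
  | _ => first | exact hp.elim | exact ⟨_, by constructor, le_rfl, rfl⟩

theorem Sim.straight {p : Prog} {s : State} {a : α} {τ : ℕ} {Q : α → State → Prop}
    (hp : Straight p) (hτ : cost n p ≤ τ) (h : Q a (final E p s)) : Sim E p s (ret a) τ Q := by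
  intro a' l hr
  cases hr
  obtain ⟨j, h₁, h₂, h₃⟩ := hp.exec (E := E) s
  exact ⟨_, j, h₁, h₂.trans hτ, h₃, h⟩

section Access

variable (s : State) (d k : ℕ) (x : ℝ)

theorem setReg_reg : (s.setReg d k).reg = Function.update s.reg d k := rfl
theorem setReg_mem : (s.setReg d k).mem = s.mem := rfl
theorem setMem_reg : (s.setMem d x).reg = s.reg := rfl
theorem setMem_mem : (s.setMem d x).mem = Function.update s.mem (s.reg d) x := rfl
theorem mem_set (v : Fin n) : v ∈ s.set n k ↔ s.mem (k + v) ≠ 0 := by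
  simp [State.set]

theorem set_setMem_of_ne_zero (u : Fin n) (h : s.reg d = k + u) (hx : x ≠ 0) :
    (s.setMem d x).set n k = insert u (s.set n k) := by
  ext v
  by_cases hvu : v = u
  · simp [mem_set, setMem_mem, h, hvu, hx]
  · have : v.1 ≠ u.1 := fun h => hvu (Fin.ext h)
    simp [mem_set, setMem_mem, h, hvu, Function.update_of_ne, this]

theorem set_setMem_zero (u : Fin n) (h : s.reg d = k + u) :
    (s.setMem d 0).set n k = (s.set n k).erase u := by
  ext v
  by_cases hvu : v = u
  · simp [mem_set, setMem_mem, h, hvu]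
  · have : v.1 ≠ u.1 := fun h => hvu (Fin.ext h)
    simp [mem_set, setMem_mem, h, hvu, Function.update_of_ne, this]

theorem set_setMem_of_notMem (h : ¬ (k ≤ s.reg d ∧ s.reg d < k + n)) :
    (s.setMem d x).set n k = s.set n k := by
  ext v
  rw [mem_set, mem_set, setMem_mem, Function.update_of_ne (by omega)]

theorem setVec_reg (y : Fin n → ℝ) : (s.setVec k y).reg = s.reg := rfl

theorem setVec_mem_add (y : Fin n → ℝ) (v : Fin n) : (s.setVec k y).mem (k + v) = y v := by
  simp [State.setVec]

theorem setVec_mem_of_notMem (y : Fin n → ℝ) {a : ℕ} (h : ¬ (k ≤ a ∧ a < k + n)) :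
    (s.setVec k y).mem a = s.mem a :=
  dif_neg fun h' => h (by omega)

end Access

end RealRAM

/-! ### The program -/

namespace SymGreedy

open RealRAM CoinTree

/-- Sample the entry that register `22` points to. -/
def entryProg : Prog :=
  .seq (block [.memAdd 19 21 10, .memConst 18 0])
    -- Registers cannot be multiplied, so `T` is held in a real cell and the loop counters compared
    -- with it are real cells too.
    (.seq (.while (.memLt 18 12)
        (.seq (.coin 20) (block [.memAdd 19 19 19, .memSub 19 19 20, .memAdd 18 18 11])))
      (.ite (.memLt 10 19) (.memConst 22 1) (.memConst 22 0)))

/-- Sample a random set. -/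
def setProg : Prog :=
  .seq (block [.regAdd 21 0 0, .regAdd 22 3 0])
    (.while (.regLt 21 2) (.seq entryProg (block [.regAdd 21 21 1, .regAdd 22 22 1])))

/-- Sum up samples of a marginal value. -/
def sumProg : Prog :=
  .seq (block [.memConst 6 0, .memConst 17 0])
    (.while (.memLt 17 12) (.seq setProg
      -- The bit of `u` in the sampled set is forced to `1` and then to `0`; the difference of the
      -- two queries is the marginal value.
      (.seq (block [.memConst 7 1, .value 19 3, .memAdd 6 6 19])
        (block [.memConst 7 0, .value 19 3, .memSub 6 6 19, .memAdd 17 17 11]))))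

def startProg : Prog :=
  block [.regAdd 5 0 0, .regAdd 6 2 0, .regAdd 7 3 0, .regAdd 8 4 0]

def nextProg : Prog :=
  block [.regAdd 5 5 1, .regAdd 6 6 1, .regAdd 7 7 1, .regAdd 8 8 1]

def weightsProg : Prog :=
  .seq startProg (.while (.regLt 5 2) (.seq sumProg
    (.seq (block [.memSub 19 11 5, .memSub 19 19 5, .memMul 19 19 8, .memMul 6 6 19]) nextProg)))

def moveProg : Prog :=
  .seq startProg (.while (.regLt 5 2)
    (.seq (block [.memSub 19 11 5, .memSub 19 19 5, .memMul 19 19 8, .memMul 19 19 7,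
      .memMul 19 19 13, .memAdd 5 5 19]) nextProg))

def stepProg : Prog :=
  .seq weightsProg (.seq (.linOpt 3 2) moveProg)

/-- Place the arrays and the scalar variables in the memory. -/
def layoutProg : Prog :=
  block [.regConst 1 1, .regSize 2, .regAdd 3 2 2, .regAdd 4 3 2, .regAdd 10 3 3, .regAdd 11 10 1,
    .regAdd 12 11 1, .regAdd 13 12 1, .regAdd 14 13 1, .regAdd 15 14 1, .regAdd 16 15 1,
    .regAdd 17 16 1, .regAdd 18 17 1, .regAdd 19 18 1, .regAdd 20 19 1]

/-- Find the feasible singletons, and count the elements. -/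
def maskProg : Prog :=
  -- Cell `12` starts at `2` and is incremented once per element: this transfers `n + 2` from the
  -- registers to the real memory.
  .seq startProg (.seq (block [.memConst 11 1, .memConst 12 2]) (.while (.regLt 5 2)
    (.seq (block [.memConst 6 1, .linOpt 3 2, .memConst 6 0])
      (.seq (.ite (.memLt 7 11) .skip (.memConst 8 1)) (.seq (.memAdd 12 12 11) nextProg)))))

def paramProg : Prog :=
  block [.memMul 12 12 12, .memMul 12 12 12, .memDiv 13 11 12, .memAdd 14 13 13, .memSub 14 11 14,
    .memAdd 15 14 10, .memParam 16, .memAdd 16 16 16]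

def greedyProg : Prog :=
  .seq layoutProg (.seq maskProg (.seq paramProg
    (.while (.memLt 16 15) (.seq (.memMul 15 15 14) stepProg))))

variable {n : ℕ}

/-- Memory map. Four arrays of length `n`: the solution `x` at `0` (where the output is read), the
weights at `n`, the sampled set or the oracle's answer at `2n`, the mask at `3n`. From `4n` on: `0`,
`1`, `T`, `1/T`, `1 - 2/T`, the current power of `1 - 2/T`, `2ε`, the sample counter, the digit
counter, a scratch cell, the last coin. Registers `5` to `8`, `21` and `22` are moving pointers. -/
structure Layout (n : ℕ) (s : State) : Prop where
  r0 : s.reg 0 = 0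
  r1 : s.reg 1 = 1
  r2 : s.reg 2 = n
  r3 : s.reg 3 = 2 * n
  r4 : s.reg 4 = 3 * n
  r10 : s.reg 10 = 4 * n
  r11 : s.reg 11 = 4 * n + 1
  r12 : s.reg 12 = 4 * n + 2
  r13 : s.reg 13 = 4 * n + 3
  r14 : s.reg 14 = 4 * n + 4
  r15 : s.reg 15 = 4 * n + 5
  r16 : s.reg 16 = 4 * n + 6
  r17 : s.reg 17 = 4 * n + 7
  r18 : s.reg 18 = 4 * n + 8
  r19 : s.reg 19 = 4 * n + 9
  r20 : s.reg 20 = 4 * n + 10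

/-- The state of the machine between two steps of the algorithm, whose current solution is `x`. -/
structure Ctx (ε : ℝ) (T : ℕ) (m x : Fin n → ℝ) (z : ℝ) (s : State) : Prop
    extends Layout n s where
  hx : ∀ v : Fin n, s.mem v = x v
  hm : ∀ v : Fin n, s.mem (3 * n + v) = m v
  hzero : s.mem (4 * n) = 0
  hone : s.mem (4 * n + 1) = 1
  hT : s.mem (4 * n + 2) = T
  hδ : s.mem (4 * n + 3) = 1 / T
  hq : s.mem (4 * n + 4) = 1 - 2 / T
  hz : s.mem (4 * n + 5) = z
  hε : s.mem (4 * n + 6) = 2 * ε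

/-- Register `5` and its companions point to the entries of `u`. -/
structure Ptr (n u : ℕ) (s : State) : Prop where
  r5 : s.reg 5 = u
  r6 : s.reg 6 = n + u
  r7 : s.reg 7 = 2 * n + u
  r8 : s.reg 8 = 3 * n + u

theorem Layout.congr {s s' : State} (h : Layout n s)
    (hr : ∀ r, r < 5 ∨ (10 ≤ r ∧ r < 21) → s'.reg r = s.reg r) : Layout n s' := by
  constructor <;> rw [hr _ (by omega)]
  exacts [h.r0, h.r1, h.r2, h.r3, h.r4, h.r10, h.r11, h.r12, h.r13, h.r14, h.r15, h.r16, h.r17,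
    h.r18, h.r19, h.r20]

/-- Frame rule: the subroutines may overwrite the two middle arrays, the cells from `4n + 7` on, and
the pointer registers. -/
theorem Ctx.congr {ε : ℝ} {T : ℕ} {m x : Fin n → ℝ} {z : ℝ} {s s' : State} (h : Ctx ε T m x z s)
    (hr : ∀ r, r < 5 ∨ (10 ≤ r ∧ r < 21) → s'.reg r = s.reg r)
    (ha : ∀ a, a < 4 * n + 7 → ¬ (n ≤ a ∧ a < 3 * n) → s'.mem a = s.mem a) :
    Ctx ε T m x z s' where
  toLayout := h.toLayout.congr hr
  hx v := by rw [ha _ (by omega) (by omega), h.hx]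
  hm v := by rw [ha _ (by omega) (by omega), h.hm]
  hzero := by rw [ha _ (by omega) (by omega), h.hzero]
  hone := by rw [ha _ (by omega) (by omega), h.hone]
  hT := by rw [ha _ (by omega) (by omega), h.hT]
  hδ := by rw [ha _ (by omega) (by omega), h.hδ]
  hq := by rw [ha _ (by omega) (by omega), h.hq]
  hz := by rw [ha _ (by omega) (by omega), h.hz]
  hε := by rw [ha _ (by omega) (by omega), h.hε]

theorem Ptr.congr {u : ℕ} {s s' : State} (h : Ptr n u s)
    (hr : ∀ r, 5 ≤ r ∧ r < 9 → s'.reg r = s.reg r) : Ptr n u s' := by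
  constructor <;> rw [hr _ (by omega)]
  exacts [h.r5, h.r6, h.r7, h.r8]

/-! ### The program simulates the algorithm -/

section Programs

variable {ε : ℝ} {T : ℕ} {m x : Fin n → ℝ} {z : ℝ} {s : State} {E : Env n}

theorem sim_entry (h : Ctx ε T m x z s) (v : Fin n) (h21 : s.reg 21 = v)
    (h22 : s.reg 22 = 2 * n + v) :
    Sim E entryProg s (bernoulli T (x v)) (6 * T + 7) fun b s' => s'.reg = s.reg ∧
      (∀ a, a < 4 * n + 8 → a ≠ 2 * n + v → s'.mem a = s.mem a) ∧ s'.mem (2 * n + v) = b := by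
  have hv := v.isLt
  refine Sim.mono (τ := 3 + ((T * (5 + 1) + 1) + 3)) ?_ (by omega) fun _ _ h => h
  refine Sim.seqRet (R := fun s' => s'.reg = s.reg ∧ (∀ a, a < 4 * n + 8 → s'.mem a = s.mem a) ∧
    s'.mem (4 * n + 8) = 0 ∧ s'.mem (4 * n + 9) = x v)
    (Sim.straight ⟨trivial, trivial, trivial⟩ le_rfl ?_) fun s₁ hs₁ => ?_
  · simp only [block, final, State.get, setMem_reg, setMem_mem, h.r10, h.r18, h.r19, h21]
    refine ⟨trivial, fun a ha => ?_, ?_, ?_⟩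
    · simp (disch := omega) only [Function.update_of_ne]
    · simp
    · simp (disch := omega) only [Function.update_of_ne, Function.update_self, h.hx, h.hzero,
        add_zero]
  · refine Sim.seq (R := fun t s' => s'.reg = s.reg ∧
      (∀ a, a < 4 * n + 8 → s'.mem a = s.mem a) ∧ s'.mem (4 * n + 9) = t) ?_ ?_
    · refine (Sim.whileLoop (fun i t s' => s'.reg = s.reg ∧
        (∀ a, a < 4 * n + 8 → s'.mem a = s.mem a) ∧ s'.mem (4 * n + 8) = i ∧
        s'.mem (4 * n + 9) = t) ?_ ?_ (by simpa using hs₁)).mono le_rfl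
        fun t s' h => ⟨h.1, h.2.1, h.2.2.2⟩
      · rintro i t s₂ hi ⟨k₁, k₂, k₃, k₄⟩
        have hT := h.hT
        rw [← k₂ _ (by omega)] at hT
        have hone := h.hone
        rw [← k₂ _ (by omega)] at hone
        refine ⟨?_, ?_⟩
        · simp only [Test.holds, State.get, k₁, h.r18, h.r12, hT, k₃]
          exact_mod_cast hi
        · refine Sim.seq (t := flip fun c => ret c)
            (g := fun c => ret (t + t - if c then 1 else 0)) (τ := 1) (τ' := 4)
            (R := fun c s' => s'.reg = s₂.reg ∧
              s'.mem = Function.update s₂.mem (4 * n + 10) (if c then 1 else 0))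
            (Sim.coin fun c l => ⟨rfl, ?_⟩) ?_
          · simp only [setMem_mem, k₁, h.r20]
          · rintro c s₃ ⟨q₁, q₂⟩
            refine Sim.straight ⟨trivial, trivial, trivial, trivial⟩ le_rfl ?_
            simp only [block, final, State.get, setMem_reg, setMem_mem, q₁, q₂, k₁, h.r11, h.r18,
              h.r19, h.r20]
            refine ⟨trivial, fun a ha => ?_, ?_, ?_⟩
            · simp (disch := omega) only [Function.update_of_ne, k₂]
            · simp (disch := omega) only [Function.update_of_ne, Function.update_self, k₃, hone]
              push_cast
              rfl
            · simp (disch := omega) only [Function.update_of_ne, Function.update_self, k₄]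
      · rintro t s₂ ⟨k₁, k₂, k₃, k₄⟩
        have hT := h.hT
        rw [← k₂ _ (by omega)] at hT
        simp only [Test.holds, State.get, k₁, h.r18, h.r12, hT, k₃, lt_irrefl, not_false_eq_true]
    · rintro t s₂ ⟨k₁, k₂, k₃⟩
      refine Sim.straight ⟨trivial, trivial⟩ le_rfl ?_
      have hzero := h.hzero
      rw [← k₂ _ (by omega)] at hzero
      simp only [final, Test.holds, State.get, k₁, h.r10, h.r19, hzero, k₃]
      split_ifs <;> simp only [setMem_reg, setMem_mem, k₁, h22, Function.update_self] <;>
        refine ⟨trivial, fun a ha hne => ?_, by norm_num⟩ <;>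
        simp (disch := omega) only [Function.update_of_ne, k₂]

theorem sim_set (h : Ctx ε T m x z s) :
    Sim E setProg s (fill fun v => bernoulli T (x v)) (n * (6 * T + 11) + 4) fun b s' =>
      (∀ r, r < 21 → s'.reg r = s.reg r) ∧
      (∀ a, a < 4 * n + 8 → ¬ (2 * n ≤ a ∧ a < 3 * n) → s'.mem a = s.mem a) ∧
      ∀ v : Fin n, s'.mem (2 * n + v) = b v := by
  refine Sim.mono (τ := 3 + (n * ((6 * T + 7 + 3) + 1) + 1)) ?_ (by
    rw [show 6 * T + 7 + 3 + 1 = 6 * T + 11 by ring]; omega) fun _ _ h => h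
  refine Sim.seqRet (R := fun s' => (∀ r, r < 21 → s'.reg r = s.reg r) ∧ s'.mem = s.mem ∧
    s'.reg 21 = 0 ∧ s'.reg 22 = 2 * n) (Sim.straight ⟨trivial, trivial, trivial⟩ le_rfl ?_)
    fun s₁ hs₁ => ?_
  · simp only [block, final, setReg_reg, setReg_mem]
    refine ⟨fun r hr => ?_, trivial, ?_, ?_⟩ <;>
      simp (disch := omega) only [Function.update_of_ne, Function.update_self, h.r0, h.r3, add_zero]
  · refine (Sim.whileLoop (fun i b s' => (∀ r, r < 21 → s'.reg r = s.reg r) ∧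
      (∀ a, a < 4 * n + 8 → ¬ (2 * n ≤ a ∧ a < 3 * n) → s'.mem a = s.mem a) ∧
      (∀ v : Fin n, v.1 < i → s'.mem (2 * n + v) = b v) ∧ s'.reg 21 = i ∧ s'.reg 22 = 2 * n + i)
      ?_ ?_ ⟨hs₁.1, fun a _ _ => by rw [hs₁.2.1], fun v hv => absurd hv (by omega), hs₁.2.2.1,
        hs₁.2.2.2⟩).mono le_rfl fun b s' k => ⟨k.1, k.2.1, fun v => k.2.2.1 v v.isLt⟩
    · rintro i b s₂ hi ⟨k₁, k₂, k₃, k₄, k₅⟩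
      have hC : Ctx ε T m x z s₂ := h.congr (fun r _ => k₁ r (by omega))
        fun a _ _ => k₂ a (by omega) (by omega)
      refine ⟨?_, ?_⟩
      · simp only [Test.holds, k₄, hC.r2]
        exact hi
      · rw [dif_pos hi]
        refine Sim.seq (τ := 6 * T + 7) (τ' := 3) (sim_entry hC ⟨i, hi⟩ k₄ k₅) ?_
        rintro c s₃ ⟨q₁, q₂, q₃⟩
        refine Sim.straight ⟨trivial, trivial, trivial⟩ le_rfl ?_
        simp only [block, final, setReg_reg, setReg_mem]
        refine ⟨fun r hr => ?_, fun a ha ha' => ?_, fun v hv => ?_, ?_, ?_⟩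
        · simp (disch := omega) only [Function.update_of_ne, q₁, k₁]
        · rw [q₂ a ha (by simp only; omega), k₂ a ha ha']
        · by_cases hvi : v = ⟨i, hi⟩
          · rw [hvi, Function.update_self]
            exact q₃
          · have : v.1 ≠ i := fun h => hvi (Fin.ext h)
            rw [Function.update_of_ne hvi, q₂ _ (by omega) (by simp only; omega),
              k₃ v (by omega)]
        · simp (disch := omega) only [Function.update_of_ne, Function.update_self, q₁, k₄, hC.r1]
        · simp (disch := omega) only [Function.update_of_ne, Function.update_self, q₁, k₅, hC.r1,
            add_assoc]
    · rintro b s₂ ⟨k₁, k₂, k₃, k₄, k₅⟩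
      simp only [Test.holds, k₄, k₁ 2 (by omega), h.r2, lt_irrefl, not_false_eq_true]

theorem sim_sum {f : Finset (Fin n) → ℝ} (hE : E.value = f) (h : Ctx ε T m x z s) (u : Fin n)
    (hu : Ptr n u s) :
    Sim E sumProg s (sampleSum f T x u) (T * (n * (6 * T + 11) + 2 * n + 14) + 4) fun q s' =>
      (∀ r, r < 21 → s'.reg r = s.reg r) ∧
      (∀ a, a < 4 * n + 7 → ¬ (2 * n ≤ a ∧ a < 3 * n) → a ≠ n + u → s'.mem a = s.mem a) ∧
      s'.mem (n + u) = q := by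
  have hun := u.isLt
  refine Sim.mono (τ := 3 + (T * ((n * (6 * T + 11) + 4 + (n + 4 + (n + 5))) + 1) + 1)) ?_ (by
    rw [show n * (6 * T + 11) + 4 + (n + 4 + (n + 5)) + 1 = n * (6 * T + 11) + 2 * n + 14 by ring]
    omega) fun _ _ h => h
  refine Sim.seqRet (R := fun s' => s'.reg = s.reg ∧
      (∀ a, a < 4 * n + 7 → a ≠ n + u → s'.mem a = s.mem a) ∧
      s'.mem (n + u) = 0 ∧ s'.mem (4 * n + 7) = 0)
    (Sim.straight ⟨trivial, trivial, trivial⟩ le_rfl ?_) fun s₁ hs₁ => ?_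
  · simp only [block, final, setMem_reg, setMem_mem, hu.r6, h.r17]
    refine ⟨trivial, fun a _ _ => ?_, ?_, ?_⟩ <;>
      simp (disch := omega) only [Function.update_of_ne, Function.update_self, Rat.cast_zero]
  · refine (Sim.whileLoop (fun i q s' => (∀ r, r < 21 → s'.reg r = s.reg r) ∧
      (∀ a, a < 4 * n + 7 → ¬ (2 * n ≤ a ∧ a < 3 * n) → a ≠ n + u → s'.mem a = s.mem a) ∧
      s'.mem (n + u) = q ∧ s'.mem (4 * n + 7) = i)
      ?_ ?_ ⟨fun r _ => by rw [hs₁.1], fun a h₁ _ h₂ => hs₁.2.1 a h₁ h₂, hs₁.2.2.1,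
        by simpa using hs₁.2.2.2⟩).mono le_rfl fun b s' k => ⟨k.1, k.2.1, k.2.2.1⟩
    · rintro i q s₂ hi ⟨k₁, k₂, k₃, k₄⟩
      have hC : Ctx ε T m x z s₂ := h.congr (fun r _ => k₁ r (by omega))
        fun a _ _ => k₂ a (by omega) (by omega) (by omega)
      refine ⟨?_, ?_⟩
      · simp only [Test.holds, State.get, hC.r17, hC.r12, k₄, hC.hT]
        exact_mod_cast hi
      · refine Sim.seq (τ := n * (6 * T + 11) + 4) (τ' := n + 4 + (n + 5)) (sim_set hC) ?_
        rintro b s₃ ⟨q₁, q₂, q₃⟩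
        have hC₃ : Ctx ε T m x z s₃ := hC.congr (fun r _ => q₁ r (by omega))
          fun a _ _ => q₂ a (by omega) (by omega)
        have hu₃ : Ptr n u s₃ := hu.congr fun r hr => by rw [q₁ r (by omega), k₁ r (by omega)]
        set S : Finset (Fin n) := {v | b v ≠ 0} with hSb
        have hS : s₃.set n (2 * n) = S := by
          ext v
          simp [mem_set, q₃, hSb]
        refine Sim.seqRet (τ := n + 4) (τ' := n + 5) (R := fun s' => s'.reg = s₃.reg ∧
          (∀ a, a < 4 * n + 8 → a ≠ 2 * n + u → a ≠ n + u → s'.mem a = s₃.mem a) ∧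
          s'.mem (n + u) = s₃.mem (n + u) + f (insert u S) ∧
          s'.set n (2 * n) = insert u S)
          (Sim.straight ⟨trivial, trivial, trivial, trivial⟩
            (by simp only [cost, block]; omega) ?_) fun s₄ hs₄ => ?_
        · have e := set_setMem_of_ne_zero s₃ 7 (2 * n) ((1 : ℚ) : ℝ) u hu₃.r7 (by norm_num)
          simp only [block, final, State.get, setMem_reg, hC₃.r3, hE, e, hS]
          refine ⟨trivial, fun a h₁ h₂ h₃ => ?_, ?_, ?_⟩
          · simp (disch := omega) only [setMem_mem, setMem_reg, hu₃.r6, hu₃.r7, hC₃.r19,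
              Function.update_of_ne]
          · simp (disch := omega) only [setMem_mem, setMem_reg, hu₃.r6, hu₃.r7, hC₃.r19,
              Function.update_of_ne, Function.update_self]
          · rw [set_setMem_of_notMem, set_setMem_of_notMem, e, hS]
            · rw [setMem_reg, hC₃.r19]
              omega
            · rw [setMem_reg, setMem_reg, hu₃.r6]
              omega
        · obtain ⟨p₁, p₂, p₃, p₄⟩ := hs₄
          refine Sim.straight ⟨trivial, trivial, trivial, trivial, trivial⟩
            (by simp only [cost, block]; omega) ?_
          have e := set_setMem_zero s₄ 7 (2 * n) u (by rw [p₁]; exact hu₃.r7)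
          simp only [block, final, State.get, setMem_reg, p₁, hC₃.r3, hE, Rat.cast_zero, e, p₄,
            Finset.erase_insert_eq_erase]
          simp only [setMem_mem, setMem_reg, p₁, hu₃.r6, hu₃.r7, hC₃.r11, hC₃.r17, hC₃.r19]
          refine ⟨fun r hr => ?_, fun a h₁ h₂ h₃ => ?_, ?_, ?_⟩
          · rw [q₁ r hr, k₁ r hr]
          · simp (disch := omega) only [Function.update_of_ne]
            rw [p₂ a (by omega) (by omega) h₃, q₂ a (by omega) h₂, k₂ a h₁ h₂ h₃]
          · simp (disch := omega) only [Function.update_of_ne, Function.update_self]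
            rw [p₃, q₂ _ (by omega) (by omega), k₃, marginal]
            ring
          · simp (disch := omega) only [Function.update_of_ne, Function.update_self]
            rw [p₂ _ (by omega) (by omega) (by omega), p₂ _ (by omega) (by omega) (by omega),
              hC₃.hone, q₂ _ (by omega) (by omega), k₄]
            push_cast
            rfl
    · rintro b s₂ ⟨k₁, k₂, k₃, k₄⟩
      have hC : Ctx ε T m x z s₂ := h.congr (fun r _ => k₁ r (by omega))
        fun a _ _ => k₂ a (by omega) (by omega) (by omega)
      simp only [Test.holds, State.get, hC.r17, hC.r12, k₄, hC.hT, lt_irrefl, not_false_eq_true]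

theorem sim_start (h : Layout n s) : Sim E startProg s (ret ()) 5 fun _ s' =>
    s'.mem = s.mem ∧ (∀ r, r < 5 ∨ 10 ≤ r → s'.reg r = s.reg r) ∧ Ptr n 0 s' := by
  refine Sim.straight ⟨trivial, trivial, trivial, trivial, trivial⟩ le_rfl ?_
  simp only [startProg, block, final, setReg_reg, setReg_mem]
  refine ⟨trivial, fun r hr => ?_, ?_, ?_, ?_, ?_⟩ <;>
    simp (disch := omega) only [setReg_reg, Function.update_of_ne, Function.update_self, h.r0, h.r2,
      h.r3, h.r4, add_zero]

theorem final_nextProg (h1 : s.reg 1 = 1) {u : ℕ} (h : Ptr n u s) :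
    (final E nextProg s).mem = s.mem ∧
      (∀ r, r < 5 ∨ 10 ≤ r → (final E nextProg s).reg r = s.reg r) ∧
      Ptr n (u + 1) (final E nextProg s) := by
  simp only [nextProg, block, final, setReg_reg, setReg_mem]
  refine ⟨trivial, fun r hr => ?_, ?_, ?_, ?_, ?_⟩ <;>
    simp (disch := omega) only [setReg_reg, Function.update_of_ne, Function.update_self, h1, h.r5,
      h.r6, h.r7, h.r8, add_assoc]

theorem straight_nextProg : Straight nextProg := ⟨trivial, trivial, trivial, trivial, trivial⟩

theorem sim_weights {f : Finset (Fin n) → ℝ} {O : (Fin n → ℝ) → (Fin n → ℝ)} (hE : E.value = f)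
    (h : Ctx ε T (mask O) x z s) :
    Sim E weightsProg s (weights f O T x)
      (n * (T * (n * (6 * T + 11) + 2 * n + 14) + 15) + 6) fun w s' =>
      (∀ r, r < 5 ∨ (10 ≤ r ∧ r < 21) → s'.reg r = s.reg r) ∧
      (∀ a, a < 4 * n + 7 → ¬ (n ≤ a ∧ a < 3 * n) → s'.mem a = s.mem a) ∧
      ∀ v : Fin n, s'.mem (n + v) = w v := by
  set A := T * (n * (6 * T + 11) + 2 * n + 14) with hA
  refine Sim.mono (τ := 5 + (n * ((A + 4 + (5 + 5)) + 1) + 1)) ?_ (by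
    rw [show A + 4 + (5 + 5) + 1 = A + 15 by ring]; omega) fun _ _ h => h
  refine Sim.seqRet (sim_start h.toLayout) fun s₁ hs₁ => ?_
  refine (Sim.whileLoop (fun i w s' => (∀ r, r < 5 ∨ (10 ≤ r ∧ r < 21) → s'.reg r = s.reg r) ∧
      (∀ a, a < 4 * n + 7 → ¬ (n ≤ a ∧ a < 3 * n) → s'.mem a = s.mem a) ∧
      (∀ v : Fin n, v.1 < i → s'.mem (n + v) = w v) ∧ Ptr n i s')
      ?_ ?_ ⟨fun r hr => hs₁.2.1 r (by omega), fun a _ _ => by rw [hs₁.1],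
        fun v hv => absurd hv (by omega), hs₁.2.2⟩).mono le_rfl
        fun w s' k => ⟨k.1, k.2.1, fun v => k.2.2.1 v v.isLt⟩
  · rintro i w s₂ hi ⟨k₁, k₂, k₃, k₄⟩
    have hC : Ctx ε T (mask O) x z s₂ := h.congr k₁ k₂
    refine ⟨?_, ?_⟩
    · simp only [Test.holds, k₄.r5, hC.r2]
      exact hi
    · rw [dif_pos hi]
      rw [bind_assoc]
      refine Sim.seq (τ := A + 4) (τ' := 5 + 5) (sim_sum hE hC ⟨i, hi⟩ k₄) ?_
      rintro q s₃ ⟨q₁, q₂, q₃⟩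
      have hP₃ : Ptr n i s₃ := k₄.congr fun r hr => q₁ r (by omega)
      have hC₃ : Ctx ε T (mask O) x z s₃ := hC.congr (fun r hr => q₁ r (by omega))
        fun a h₁ h₂ => q₂ a h₁ (by omega) (by simp only; omega)
      refine Sim.seqRet (R := fun s' => s'.reg = s₃.reg ∧
        (∀ a, a < 4 * n + 7 → a ≠ n + i → s'.mem a = s₃.mem a) ∧
        s'.mem (n + i) = q * ((1 - x ⟨i, hi⟩ - x ⟨i, hi⟩) * mask O ⟨i, hi⟩))
        (Sim.straight ⟨trivial, trivial, trivial, trivial, trivial⟩ le_rfl ?_) fun s₄ hs₄ => ?_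
      · simp only [block, final, State.get, setMem_reg, setMem_mem, hP₃.r5, hP₃.r6, hP₃.r8,
          hC₃.r11, hC₃.r19]
        refine ⟨trivial, fun a h₁ h₂ => ?_, ?_⟩
        · simp (disch := omega) only [Function.update_of_ne]
        · simp (disch := omega) only [Function.update_of_ne, Function.update_self, hC₃.hone, q₃]
          rw [hC₃.hx ⟨i, hi⟩, hC₃.hm ⟨i, hi⟩]
      · obtain ⟨p₁, p₂, p₃⟩ := hs₄
        have h1 : s₄.reg 1 = 1 := by rw [p₁, hC₃.r1]
        have hP₄ : Ptr n i s₄ := hP₃.congr fun r _ => by rw [p₁]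
        obtain ⟨e₁, e₂, e₃⟩ := final_nextProg (E := E) h1 hP₄
        refine Sim.straight straight_nextProg le_rfl ⟨fun r hr => ?_, fun a h₁ h₂ => ?_,
          fun v hv => ?_, e₃⟩
        · rw [e₂ r (by omega), p₁, q₁ r (by omega), k₁ r hr]
        · rw [e₁, p₂ a h₁ (by omega), q₂ a h₁ (by omega) (by simp only; omega), k₂ a h₁ h₂]
        · rw [e₁]
          by_cases hvi : v = ⟨i, hi⟩
          · rw [hvi, Function.update_self]
            exact p₃
          · have : v.1 ≠ i := fun h => hvi (Fin.ext h)
            rw [Function.update_of_ne hvi, p₂ _ (by omega) (by omega),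
              q₂ _ (by omega) (by omega) (by simp only; omega), k₃ v (by omega)]
  · rintro w s₂ ⟨k₁, k₂, k₃, k₄⟩
    simp only [Test.holds, k₄.r5, k₁ 2 (by omega), h.r2, lt_irrefl, not_false_eq_true]

theorem Ctx.of_entries (h : Ctx ε T m x z s) {s' : State} {x' : Fin n → ℝ}
    (hr : ∀ r, r < 5 ∨ (10 ≤ r ∧ r < 21) → s'.reg r = s.reg r)
    (ha : ∀ a, a < 4 * n + 7 → 3 * n ≤ a → s'.mem a = s.mem a)
    (hx : ∀ v : Fin n, s'.mem v = x' v) : Ctx ε T m x' z s' where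
  toLayout := h.toLayout.congr hr
  hx := hx
  hm v := by rw [ha _ (by omega) (by omega), h.hm]
  hzero := by rw [ha _ (by omega) (by omega), h.hzero]
  hone := by rw [ha _ (by omega) (by omega), h.hone]
  hT := by rw [ha _ (by omega) (by omega), h.hT]
  hδ := by rw [ha _ (by omega) (by omega), h.hδ]
  hq := by rw [ha _ (by omega) (by omega), h.hq]
  hz := by rw [ha _ (by omega) (by omega), h.hz]
  hε := by rw [ha _ (by omega) (by omega), h.hε]

theorem sim_move {O : (Fin n → ℝ) → (Fin n → ℝ)} (h : Ctx ε T (mask O) x z s) {y : Fin n → ℝ}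
    (hy : ∀ v : Fin n, s.mem (2 * n + v) = y v) :
    Sim E moveProg s (ret (move O T x y)) (13 * n + 6) fun x' s' => Ctx ε T (mask O) x' z s' := by
  refine Sim.mono (τ := 5 + (n * (7 + 5 + 1) + 1)) ?_ (by omega) fun _ _ h => h
  refine Sim.seqRet (sim_start h.toLayout) fun s₁ hs₁ => ?_
  -- The update is done in place: entries below `i` are new, the others old. This is harmless
  -- because a step acts on each coordinate separately.
  set X : ℕ → Fin n → ℝ := fun i v => if v.1 < i then move O T x y v else x v with hX
  have key := Sim.whileRet (E := E) (b := .regLt 5 2)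
    (p := .seq (block [.memSub 19 11 5, .memSub 19 19 5, .memMul 19 19 8, .memMul 19 19 7,
      .memMul 19 19 13, .memAdd 5 5 19]) nextProg) (k := n) (τ := 7 + 5) (fun i s' =>
    Ctx ε T (mask O) (X i) z s' ∧ Ptr n i s' ∧ ∀ v : Fin n, s'.mem (2 * n + v) = y v) ?_ ?_
    (s := s₁) ⟨?_, hs₁.2.2, fun v => by rw [hs₁.1, hy]⟩
  · intro a l hr
    cases hr
    obtain ⟨s', j, h₁, h₂, h₃, h₄⟩ := key () _ rfl
    refine ⟨s', j, h₁, h₂, h₃, ?_⟩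
    have : X n = move O T x y := by
      ext v
      simp only [hX, v.isLt, if_true]
    rw [← this]
    exact h₄.1
  · rintro i s₂ hi ⟨hC, hP, k⟩
    refine ⟨?_, ?_⟩
    · simp only [Test.holds, hP.r5, hC.r2]
      exact hi
    · have hXi : X i ⟨i, hi⟩ = x ⟨i, hi⟩ := if_neg (lt_irrefl i)
      refine Sim.seqRet (R := fun s' => s'.reg = s₂.reg ∧
        (∀ a, a < 4 * n + 7 → a ≠ i → s'.mem a = s₂.mem a) ∧
        s'.mem i = move O T x y ⟨i, hi⟩)
        (Sim.straight ⟨trivial, trivial, trivial, trivial, trivial, trivial, trivial⟩ le_rfl ?_)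
        fun s₄ hs₄ => ?_
      · simp only [block, final, State.get, setMem_reg, setMem_mem, hP.r5, hP.r7, hP.r8,
          hC.r11, hC.r13, hC.r19]
        refine ⟨trivial, fun a h₁ h₂ => ?_, ?_⟩
        · simp (disch := omega) only [Function.update_of_ne]
        · simp (disch := omega) only [Function.update_of_ne, Function.update_self, hC.hone, hC.hδ]
          rw [hC.hx ⟨i, hi⟩, hC.hm ⟨i, hi⟩, k ⟨i, hi⟩, hXi]
          rfl
      · obtain ⟨p₁, p₂, p₃⟩ := hs₄
        have h1 : s₄.reg 1 = 1 := by rw [p₁, hC.r1]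
        have hP₄ : Ptr n i s₄ := hP.congr fun r _ => by rw [p₁]
        obtain ⟨e₁, e₂, e₃⟩ := final_nextProg (E := E) h1 hP₄
        refine Sim.straight straight_nextProg le_rfl ⟨hC.of_entries (fun r hr => ?_)
          (fun a h₁ h₂ => ?_) fun v => ?_, e₃, fun v => ?_⟩
        · rw [e₂ r (by omega), p₁]
        · rw [e₁, p₂ a h₁ (by omega)]
        · rw [e₁]
          by_cases hvi : v = ⟨i, hi⟩
          · rw [hvi]
            simp only [hX, Nat.lt_succ_self, if_true]
            exact p₃
          · have : v.1 ≠ i := fun h => hvi (Fin.ext h)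
            rw [p₂ _ (by omega) this, hC.hx]
            simp only [hX]
            exact if_congr (by omega) rfl rfl
        · rw [e₁, p₂ _ (by omega) (by omega), k]
  · rintro s₂ ⟨hC, hP, -⟩
    simp only [Test.holds, hP.r5, hC.r2, lt_irrefl, not_false_eq_true]
  · have : X 0 = x := by
      ext v
      simp only [hX, Nat.not_lt_zero, if_false]
    rw [this]
    exact h.congr (fun r hr => hs₁.2.1 r (by omega)) fun a _ _ => by rw [hs₁.1]

theorem sim_step {f : Finset (Fin n) → ℝ} {O : (Fin n → ℝ) → (Fin n → ℝ)} (hf : E.value = f)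
    (hO : E.linOpt = O) (h : Ctx ε T (mask O) x z s) :
    Sim E stepProg s (step f O T x) (n * (T * (n * (6 * T + 11) + 2 * n + 14) + 29) + 13)
      fun x' s' => Ctx ε T (mask O) x' z s' := by
  set A := T * (n * (6 * T + 11) + 2 * n + 14) with hA
  refine Sim.mono (τ := (n * (A + 15) + 6) + ((n + 1) + (13 * n + 6))) ?_ (by
    rw [show n * (A + 29) = n * (A + 15) + 14 * n by ring]; omega) fun _ _ h => h
  refine Sim.seq (sim_weights hf h) ?_
  rintro w s₂ ⟨k₁, k₂, k₃⟩
  have hC : Ctx ε T (mask O) x z s₂ := h.congr k₁ k₂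
  refine Sim.seqRet (R := fun s' => s' = s₂.setVec (2 * n) (O w))
    (Sim.straight trivial le_rfl ?_) ?_
  · have : s₂.vec n n = w := funext k₃
    simp only [final, hC.r2, hC.r3, this, hO]
  · rintro s₃ rfl
    refine sim_move (hC.congr (fun r _ => ?_) fun a _ _ => ?_) fun v => ?_
    · rw [setVec_reg]
    · rw [setVec_mem_of_notMem]
      omega
    · rw [setVec_mem_add]

theorem sim_layout (r : List Bool) : Sim E layoutProg (initState r) (ret ()) 16 fun _ s' =>
    Layout n s' ∧ ∀ a, s'.mem a = 0 := by
  refine Sim.straight ⟨trivial, trivial, trivial, trivial, trivial, trivial, trivial, trivial,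
    trivial, trivial, trivial, trivial, trivial, trivial, trivial, trivial⟩ le_rfl ⟨?_, fun _ => rfl⟩
  constructor <;>
    simp (disch := omega) only [layoutProg, block, final, setReg_reg, Function.update_of_ne,
      Function.update_self, initState] <;> omega

theorem sim_mask {O : (Fin n → ℝ) → (Fin n → ℝ)} (hO : E.linOpt = O) (h : Layout n s)
    (h0 : ∀ a, s.mem a = 0) :
    Sim E maskProg s (ret ()) (n * (n + 14) + 9) fun _ s' => Layout n s' ∧
      (∀ a, a < n → s'.mem a = 0) ∧ (∀ v : Fin n, s'.mem (3 * n + v) = mask O v) ∧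
      s'.mem (4 * n) = 0 ∧ s'.mem (4 * n + 1) = 1 ∧ s'.mem (4 * n + 2) = 2 + n := by
  refine Sim.mono (τ := 5 + (3 + (n * ((n + 4) + (3 + (1 + 5)) + 1) + 1))) ?_ (by
    rw [show n + 4 + (3 + (1 + 5)) + 1 = n + 14 by ring]; omega) fun _ _ h => h
  refine Sim.seqRet (sim_start h) fun s₁ ⟨a₁, a₂, a₃⟩ => ?_
  have hL₁ : Layout n s₁ := h.congr fun r hr => a₂ r (by omega)
  refine Sim.seqRet (R := fun s' => s'.reg = s₁.reg ∧ (∀ a, a < 4 * n + 1 → s'.mem a = 0) ∧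
    s'.mem (4 * n + 1) = 1 ∧ s'.mem (4 * n + 2) = 2)
    (Sim.straight ⟨trivial, trivial, trivial⟩ le_rfl ?_) fun s₂ ⟨b₁, b₂, b₃, b₄⟩ => ?_
  · simp only [block, final, setMem_reg, setMem_mem, hL₁.r11, hL₁.r12]
    refine ⟨trivial, fun a _ => ?_, ?_, ?_⟩ <;>
      simp (disch := omega) only [Function.update_of_ne, Function.update_self, a₁, h0] <;> norm_num
  refine (Sim.whileRet (fun i s' => Layout n s' ∧ Ptr n i s' ∧ (∀ a, a < 2 * n → s'.mem a = 0) ∧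
    (∀ v : Fin n, s'.mem (3 * n + v) = if v.1 < i then mask O v else 0) ∧
    s'.mem (4 * n) = 0 ∧ s'.mem (4 * n + 1) = 1 ∧ s'.mem (4 * n + 2) = 2 + i) ?_ ?_
    ⟨hL₁.congr fun r _ => by rw [b₁], a₃.congr fun r _ => by rw [b₁],
      fun a _ => b₂ a (by omega), fun v => by rw [b₂ _ (by omega), if_neg (by omega)],
      b₂ _ (by omega), b₃, by rw [b₄]; simp⟩).mono le_rfl
    fun _ s' ⟨c₁, _, c₂, c₃, c₄, c₅, c₆⟩ =>
      ⟨c₁, fun a _ => c₂ a (by omega), fun v => by rw [c₃, if_pos v.isLt], c₄, c₅, c₆⟩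
  · rintro i s₃ hi ⟨hL, hP, k₁, k₂, k₃, k₄, k₅⟩
    refine ⟨?_, ?_⟩
    · simp only [Test.holds, hP.r5, hL.r2]
      exact hi
    refine Sim.seqRet (τ := n + 4) (τ' := 3 + (1 + 5)) (R := fun s' => s'.reg = s₃.reg ∧
      (∀ a, ¬ (2 * n ≤ a ∧ a < 3 * n) → s'.mem a = s₃.mem a) ∧
      s'.mem (2 * n + i) = O (Pi.single ⟨i, hi⟩ 1) ⟨i, hi⟩)
      (Sim.straight ⟨trivial, trivial, trivial, trivial⟩
        (by simp only [cost, block]; omega) ?_) fun s₄ ⟨p₁, p₂, p₃⟩ => ?_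
    -- The weight array is still zero elsewhere: the memory starts at `0` and each round resets its
    -- own entry.
    · have hv : (s₃.setMem 6 ((1 : ℚ) : ℝ)).vec n n = Pi.single ⟨i, hi⟩ 1 := by
        ext v
        simp only [State.vec, setMem_mem, hP.r6]
        by_cases hvi : v = ⟨i, hi⟩
        · rw [hvi]
          simp
        · have : v.1 ≠ i := fun h => hvi (Fin.ext h)
          rw [Function.update_of_ne (by omega), Pi.single_eq_of_ne hvi, k₁ _ (by omega)]
      simp only [block, final, setMem_reg, setVec_reg, hL.r2, hL.r3, hv, hO]
      simp only [setMem_mem, setVec_reg, setMem_reg, hP.r6]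
      refine ⟨trivial, fun a ha => ?_, ?_⟩
      · by_cases hai : a = n + i
        · rw [hai, Function.update_self, k₁ _ (by omega), Rat.cast_zero]
        · rw [Function.update_of_ne hai, setVec_mem_of_notMem _ _ _ (by omega), setMem_mem, hP.r6,
            Function.update_of_ne hai]
      · rw [Function.update_of_ne (by omega)]
        exact setVec_mem_add _ _ _ ⟨i, hi⟩
    · refine Sim.seqRet (τ := 3) (τ' := 1 + 5) (R := fun s' => s'.reg = s₃.reg ∧
        (∀ a, ¬ (2 * n ≤ a ∧ a < 3 * n) → a ≠ 3 * n + i → s'.mem a = s₃.mem a) ∧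
        s'.mem (3 * n + i) = mask O ⟨i, hi⟩)
        (Sim.straight ⟨trivial, trivial⟩ le_rfl ?_) fun s₅ ⟨q₁, q₂, q₃⟩ => ?_
      · simp only [final, Test.holds, State.get, p₁, hP.r7, hL.r11, p₃,
          p₂ (4 * n + 1) (by omega), k₄, mask]
        split_ifs
        · refine ⟨p₁, fun a h₁ _ => p₂ a h₁, ?_⟩
          rw [p₂ _ (by omega), k₂ ⟨i, hi⟩]
          exact if_neg (lt_irrefl i)
        · simp only [setMem_reg, setMem_mem, p₁, hP.r8]
          refine ⟨trivial, fun a h₁ h₂ => ?_, ?_⟩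
          · rw [Function.update_of_ne h₂, p₂ a h₁]
          · rw [Function.update_self, Rat.cast_one]
      · refine Sim.seqRet (τ := 1) (τ' := 5) (R := fun s' => s'.reg = s₃.reg ∧ ∀ a, s'.mem a =
          if a = 4 * n + 2 then 2 + ((i + 1 : ℕ) : ℝ) else s₅.mem a)
          (Sim.straight trivial le_rfl ?_) fun s₆ ⟨d₁, d₂⟩ => ?_
        · simp only [final, State.get, setMem_reg, setMem_mem, q₁, hL.r11, hL.r12]
          refine ⟨trivial, fun a => ?_⟩
          rw [Function.update_apply, q₂ _ (by omega) (by omega), q₂ _ (by omega) (by omega), k₄, k₅]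
          push_cast
          rw [add_assoc]
        · have hP₆ : Ptr n i s₆ := hP.congr fun r _ => by rw [d₁]
          obtain ⟨e₁, e₂, e₃⟩ := final_nextProg (E := E) (by rw [d₁, hL.r1]) hP₆
          refine Sim.straight straight_nextProg le_rfl ?_
          rw [e₁]
          refine ⟨hL.congr fun r hr => by rw [e₂ r (by omega), d₁], e₃, fun a ha => ?_,
            fun v => ?_, ?_, ?_, ?_⟩
          · rw [d₂, if_neg (by omega), q₂ a (by omega) (by omega), k₁ a ha]
          · rw [d₂, if_neg (by omega)]
            by_cases hvi : v = ⟨i, hi⟩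
            · rw [hvi, if_pos (Nat.lt_succ_self i)]
              exact q₃
            · have : v.1 ≠ i := fun h => hvi (Fin.ext h)
              rw [q₂ _ (by omega) (by omega), k₂]
              exact if_congr (by omega) rfl rfl
          · rw [d₂, if_neg (by omega), q₂ _ (by omega) (by omega), k₃]
          · rw [d₂, if_neg (by omega), q₂ _ (by omega) (by omega), k₄]
          · rw [d₂, if_pos rfl]
  · rintro s₃ ⟨hL, hP, -⟩
    simp only [Test.holds, hP.r5, hL.r2, lt_irrefl, not_false_eq_true]

theorem sim_param (hε : E.param = ε) (h : Layout n s) (h0 : ∀ a, a < n → s.mem a = 0)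
    (hm : ∀ v : Fin n, s.mem (3 * n + v) = m v) (hzero : s.mem (4 * n) = 0)
    (hone : s.mem (4 * n + 1) = 1) (hN : s.mem (4 * n + 2) = 2 + n) :
    Sim E paramProg s (ret ()) 9 fun _ s' =>
      Ctx ε ((n + 2) ^ 4) m 0 (1 - 2 / (((n + 2) ^ 4 : ℕ) : ℝ)) s' := by
  refine Sim.straight ⟨trivial, trivial, trivial, trivial, trivial, trivial, trivial, trivial,
    trivial⟩ le_rfl ?_
  simp only [paramProg, block, final, State.get, setMem_reg, setMem_mem, h.r10, h.r11, h.r12, h.r13,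
    h.r14, h.r15, h.r16, hε]
  refine { h.congr (fun _ _ => rfl) with
    hx := fun v => ?_
    hm := fun v => ?_
    hzero := ?_
    hone := ?_
    hT := ?_
    hδ := ?_
    hq := ?_
    hz := ?_
    hε := ?_ }
  all_goals
    simp (disch := omega) only [setMem_mem, setMem_reg, h.r12, h.r13, h.r14, h.r15,
      h.r16, Function.update_of_ne, Function.update_self, hm, hzero, hone, hN]
  · exact h0 _ v.isLt
  all_goals push_cast
  all_goals ring

theorem Ctx.mul_factor (h : Ctx ε T m x z s) :
    Ctx ε T m x (z * (1 - 2 / T)) (final E (.memMul 15 15 14) s) := by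
  simp only [final, State.get, h.r14, h.r15, h.hz, h.hq]
  refine { h.toLayout.congr (fun _ _ => rfl) with
    hx := fun v => ?_
    hm := fun v => ?_
    hzero := ?_
    hone := ?_
    hT := ?_
    hδ := ?_
    hq := ?_
    hz := ?_
    hε := ?_ }
  all_goals
    simp (disch := omega) only [setMem_mem, h.r15, Function.update_of_ne, Function.update_self,
      h.hx, h.hm, h.hzero, h.hone, h.hT, h.hδ, h.hq, h.hε]

/-- The program performs `K` steps, where `K` is least with `(1 - 2 / T) ^ (K + 1) ≤ 2 ε`. -/
theorem sim_greedy {f : Finset (Fin n) → ℝ} {O : (Fin n → ℝ) → (Fin n → ℝ)} (r : List Bool)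
    {T K : ℕ} (hT : T = (n + 2) ^ 4) (hlt : ∀ i < K, 2 * ε < (1 - 2 / (T : ℝ)) ^ (i + 1))
    (hK : (1 - 2 / (T : ℝ)) ^ (K + 1) ≤ 2 * ε) :
    Sim (⟨ε, f, O⟩ : Env n) greedyProg (initState r) (greedy f O T K)
      (n * (n + 14) + 35 + K * (n * (T * (n * (6 * T + 11) + 2 * n + 14) + 29) + 15))
      fun x s' => s'.vec n 0 = x := by
  set B := n * (T * (n * (6 * T + 11) + 2 * n + 14) + 29) with hB
  refine Sim.mono (τ := 16 + ((n * (n + 14) + 9) + (9 + (K * ((1 + (B + 13)) + 1) + 1)))) ?_ (by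
    rw [show 1 + (B + 13) + 1 = B + 15 by ring]; omega) fun _ _ h => h
  refine Sim.seqRet (sim_layout r) fun s₁ ⟨a₁, a₂⟩ => ?_
  refine Sim.seqRet (sim_mask rfl a₁ a₂) fun s₂ ⟨b₁, b₂, b₃, b₄, b₅, b₆⟩ => ?_
  refine Sim.seqRet (sim_param rfl b₁ b₂ b₃ b₄ b₅ b₆) fun s₃ c => ?_
  rw [← hT] at c
  -- The stored power is one ahead of the number of completed steps. Stopping on it keeps `K / T ≤
  -- β` without computing a logarithm.
  refine (Sim.whileLoop (fun i x s' => Ctx ε T (mask O) x ((1 - 2 / (T : ℝ)) ^ (i + 1)) s')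
    (fun i x s hi hC => ⟨?_, ?_⟩) (fun x s hC => ?_) (by simpa using c)).mono le_rfl
    fun x s' hC => ?_
  · simp only [Test.holds, State.get, hC.r15, hC.r16, hC.hz, hC.hε]
    exact hlt i hi
  · refine Sim.seqRet (R := fun s' => Ctx ε T (mask O) x ((1 - 2 / (T : ℝ)) ^ (i + 1 + 1)) s')
      (Sim.straight trivial le_rfl ?_) fun s' hC' => sim_step rfl rfl hC'
    rw [pow_succ]
    exact hC.mul_factor
  · simp only [Test.holds, State.get, hC.r15, hC.r16, hC.hz, hC.hε]
    exact hK.not_gt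
  · ext v
    simp only [State.vec, zero_add, hC.hx]

end Programs

end SymGreedy

/-! ### From the expected shortfall to the two guarantees -/

namespace CoinTree

variable {α : Type}

theorem sub_le_mean {t : CoinTree α} {F : α → ℝ} {A e : ℝ}
    (h : t.mean (fun a => max 0 (A - F a)) ≤ e) : A - e ≤ t.mean F := by
  have h₁ := mean_le_mean (t := t) (φ := fun a => A + F a * (-1))
    (All.of_forall _ fun a => (by linarith : A + F a * (-1) = A - F a).le.trans (le_max_right 0 _))
  rw [mean_affine] at h₁
  linarith

/-- Markov's inequality for the shortfall of `F` below `A`. -/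
theorem one_sub_sqrt_le_mean {t : CoinTree α} {F : α → ℝ} {A e M : ℝ} (he : 0 < e) (hM : 0 < M)
    (h : t.mean (fun a => max 0 (A - F a)) ≤ e * M) :
    1 - Real.sqrt e ≤ t.mean fun a => if A - Real.sqrt e * M ≤ F a then 1 else 0 := by
  have hs := Real.sqrt_pos.2 he
  have h₁ : ∀ a, 1 + max 0 (A - F a) * (-(1 / (Real.sqrt e * M))) ≤
      if A - Real.sqrt e * M ≤ F a then 1 else 0 := by
    intro a
    rw [mul_neg, mul_one_div]
    split_ifs with ha
    · have : 0 ≤ max 0 (A - F a) / (Real.sqrt e * M) :=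
        div_nonneg (le_max_left _ _) (by positivity)
      linarith
    · have : 1 ≤ max 0 (A - F a) / (Real.sqrt e * M) := by
        rw [le_div_iff₀ (by positivity)]
        have := le_max_right 0 (A - F a)
        linarith
      linarith
  refine le_trans ?_ (mean_le_mean (All.of_forall _ h₁))
  rw [mean_affine, mul_neg, mul_one_div]
  have : t.mean (fun a => max 0 (A - F a)) / (Real.sqrt e * M) ≤ Real.sqrt e := by
    rw [div_le_iff₀ (by positivity)]
    nlinarith [Real.mul_self_sqrt he.le]
  linarith

end CoinTree

namespace SymGreedy

open RealRAM CoinTree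

/-- The number of steps that the stopping rule of the program allows. -/
theorem exists_steps {ε : ℝ} (hε0 : 0 < ε) (hε : ε ≤ 1 / 2) {T : ℕ} (hT : 3 ≤ T) :
    ∃ K : ℕ, (∀ i < K, 2 * ε < (1 - 2 / (T : ℝ)) ^ (i + 1)) ∧
      (1 - 2 / (T : ℝ)) ^ (K + 1) ≤ 2 * ε ∧
      (K : ℝ) / T ≤ 1 / 2 * Real.log (1 / (2 * ε)) := by
  classical
  have hT' : (3 : ℝ) ≤ T := by exact_mod_cast hT
  have hq0 : 0 < 1 - 2 / (T : ℝ) := by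
    rw [sub_pos, div_lt_one (by linarith)]
    linarith
  have hq1 : 1 - 2 / (T : ℝ) < 1 := sub_lt_self _ (by positivity)
  have hex : ∃ k : ℕ, (1 - 2 / (T : ℝ)) ^ (k + 1) ≤ 2 * ε := by
    obtain ⟨k, hk⟩ := exists_pow_lt_of_lt_one (by linarith : (0 : ℝ) < 2 * ε) hq1
    exact ⟨k, (pow_le_pow_of_le_one hq0.le hq1.le (Nat.le_succ k)).trans hk.le⟩
  have hlt : ∀ i < Nat.find hex, 2 * ε < (1 - 2 / (T : ℝ)) ^ (i + 1) :=
    fun i hi => not_le.1 (Nat.find_min hex hi)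
  refine ⟨Nat.find hex, hlt, Nat.find_spec hex, ?_⟩
  rw [one_div (2 * ε), Real.log_inv]
  generalize Nat.find hex = K at hlt
  cases K with
  | zero =>
    have := Real.log_nonpos (by linarith : 0 ≤ 2 * ε) (by linarith)
    simp only [Nat.cast_zero, zero_div]
    linarith
  | succ k =>
    -- The last successful test says `2ε < (1 - 2/T) ^ K`; with `log (1 - 2/T) ≤ -2/T` this gives
    -- `2K/T < log (1/(2ε))`.
    have h₁ := Real.log_lt_log (by linarith) (hlt k (Nat.lt_succ_self k))
    rw [Real.log_pow] at h₁
    have h₂ := Real.log_le_sub_one_of_pos hq0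
    have h₃ := mul_le_mul_of_nonneg_left h₂ (Nat.cast_nonneg (k + 1) : (0 : ℝ) ≤ ((k + 1 : ℕ) : ℝ))
    have h₄ : ((k + 1 : ℕ) : ℝ) * (1 - 2 / (T : ℝ) - 1) = -2 * (((k + 1 : ℕ) : ℝ) / T) := by ring
    linarith

open Polynomial in
/-- A bound for the running time; `B` bounds the length of the trajectory. -/
noncomputable def timeBound (B : ℕ) : ℕ[X] :=
  X * (X + 14) + 35 + C B * (X + 2) ^ 4 *
    (X * ((X + 2) ^ 4 * (X * (6 * (X + 2) ^ 4 + 11) + 2 * X + 14) + 29) + 15)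

theorem eval_timeBound (B n : ℕ) : (timeBound B).eval n = n * (n + 14) + 35 + B * (n + 2) ^ 4 *
    (n * ((n + 2) ^ 4 * (n * (6 * (n + 2) ^ 4 + 11) + 2 * n + 14) + 29) + 15) := by
  simp [timeBound]

variable {n : ℕ} {f : Finset (Fin n) → ℝ} {O : (Fin n → ℝ) → (Fin n → ℝ)} {P : Set (Fin n → ℝ)}

theorem mean_shortfall_le (h0 : ∀ S, 0 ≤ f S) (hf : IsSubmodular f) (hs : IsSymmetricSetFun f)
    (hP : P ⊆ {x | ∀ u, 0 ≤ x u ∧ x u ≤ 1}) (hd : IsDownClosed P) (hO : IsLinOptOracle P O)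
    {S : Finset (Fin n)} (hS : IsIntegerOptimum f P S) {ε β : ℝ} {T K : ℕ}
    (hT : T = (n + 2) ^ 4) (hK : (1 - 2 / (T : ℝ)) ^ (K + 1) ≤ 2 * ε) (hβ : (K : ℝ) / T ≤ β) :
    (greedy f O T K).mean (fun x =>
      max 0 ((1 / 2 - ε - 1 / ((n : ℝ) + 2)) * f S - multilinearExt f x)) ≤
      5 * (β + 1) / ((n : ℝ) + 2) * f S := by
  have hM := h0 S
  have hN : (2 : ℝ) ≤ (n : ℝ) + 2 := by
    have : (0 : ℝ) ≤ n := Nat.cast_nonneg n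
    linarith
  set N : ℝ := (n : ℝ) + 2 with hNdef
  have hTN : (T : ℝ) = N ^ 4 := by rw [hT]; push_cast; rfl
  have hNT : N ≤ T := by rw [hTN]; exact le_self_pow₀ (by linarith) (by norm_num)
  have hT2 : 2 ≤ T := by
    have : (2 : ℝ) ≤ T := hN.trans hNT
    exact_mod_cast this
  have hT0 : (0 : ℝ) < T := by linarith
  have hq : (0 : ℝ) ≤ 1 - 2 / T ∧ 1 - 2 / (T : ℝ) ≤ 1 := by
    constructor
    · rw [sub_nonneg, div_le_one hT0]
      linarith
    · rw [sub_le_self_iff]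
      positivity
  have h₁ := mean_greedy_le h0 hf hs hP hd hO hS (L := (n + 2) ^ 2) (by rw [hT]; ring) hT2 K
  have h₂ : 1 / 2 - ε - 1 / N ≤ (1 - (1 - 2 / (T : ℝ)) ^ K) / 2 := by
    -- The stopping rule controls the power `K + 1`. Going back to `K` costs at most `2/T`, hence
    -- `1/T ≤ 1/N` after halving.
    have h₃ := pow_le_one₀ (n := K) hq.1 hq.2
    have h₄ : 0 ≤ (1 - 2 / (T : ℝ)) ^ K := pow_nonneg hq.1 K
    have h₅ : 1 / (T : ℝ) ≤ 1 / N := one_div_le_one_div_of_le (by linarith) hNT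
    have h₆ : (2 : ℝ) / T * (1 - 2 / (T : ℝ)) ^ K ≤ 2 / T :=
      mul_le_of_le_one_right (by positivity) h₃
    have h₇ : (2 : ℝ) / T = 2 * (1 / T) := by ring
    rw [pow_succ] at hK
    linarith
  refine (mean_le_mean (All.of_forall _ fun x => max_le_max le_rfl (sub_le_sub_right
    (mul_le_mul_of_nonneg_right h₂ hM) _))).trans (h₁.trans ?_)
  rw [← mul_assoc]
  refine mul_le_mul_of_nonneg_right ?_ hM
  have h₃ : (n : ℝ) * ((n + 2) ^ 2 : ℕ) + 4 * (n : ℝ) ^ 2 ≤ 5 * N ^ 3 := by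
    have hn : (0 : ℝ) ≤ n := Nat.cast_nonneg n
    push_cast
    rw [hNdef]
    nlinarith [pow_nonneg hn 3, pow_nonneg hn 2]
  calc (K : ℝ) * ((1 / (T : ℝ)) ^ 2 * ((n : ℝ) * ((n + 2) ^ 2 : ℕ) + 4 * (n : ℝ) ^ 2))
      ≤ K * ((1 / (T : ℝ)) ^ 2 * (5 * N ^ 3)) := by gcongr
    -- This is where the exponent `4` matters: `N ^ 3 / T = 1 / N`.
    _ = K / T * (5 / N) := by
      rw [hTN]
      field_simp
    _ ≤ (β + 1) * (5 / N) := by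
      refine mul_le_mul_of_nonneg_right (by linarith) (by positivity)
    _ = 5 * (β + 1) / N := by ring

theorem tendsto_err (c : ℝ) : Tendsto (fun n : ℕ => 1 / ((n : ℝ) + 2) + c / ((n : ℝ) + 2) +
    Real.sqrt (c / ((n : ℝ) + 2))) atTop (𝓝 0) := by
  have h : Tendsto (fun n : ℕ => (n : ℝ) + 2) atTop atTop :=
    tendsto_atTop_add_const_right _ _ tendsto_natCast_atTop_atTop
  have h₁ := (h.const_div_atTop 1).add (h.const_div_atTop c)
  have h₂ := (Real.continuous_sqrt.tendsto 0).comp (h.const_div_atTop c)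
  simpa using h₁.add h₂

end SymGreedy

open RealRAM CoinTree SymGreedy in
theorem mainTheorem8 (ε : ℝ) (hε0 : 0 < ε) (hε : ε ≤ 1 / 2) :
    ∃ (p : RealRAM.Prog) (time : Polynomial ℕ) (err : ℕ → ℝ),
      Tendsto err atTop (𝓝 0) ∧
      ∀ (n : ℕ) (f : Finset (Fin n) → ℝ) (P : Set (Fin n → ℝ)) (O : (Fin n → ℝ) → (Fin n → ℝ)),
        (∀ S, 0 ≤ f S) → IsSubmodular f → IsSymmetricSetFun f →
        P ⊆ {x | ∀ u, 0 ≤ x u ∧ x u ≤ 1} → Convex ℝ P → IsDownClosed P →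
        IsLinOptOracle P O →
        ∃ out : (Fin (time.eval n) → Bool) → (Fin n → ℝ),
          (∀ r, RealRAM.HaltsWithin ⟨ε, f, O⟩ p (List.ofFn r) (time.eval n) (out r)) ∧
          (∀ r, IsBicriteriaFeasible P (1 / 2 * Real.log (1 / (2 * ε))) (out r)) ∧
          ∀ OPT, IsIntegerOptimum f P OPT →
            (1 / 2 - ε - err n) * f OPT ≤ coinExpect (fun r => multilinearExt f (out r)) ∧
            1 - err n ≤ coinProb
              (fun r => (1 / 2 - ε - err n) * f OPT ≤ multilinearExt f (out r)) := by
  classical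
  set β := 1 / 2 * Real.log (1 / (2 * ε)) with hβ
  have hβ0 : 0 ≤ β := by
    have : 0 ≤ Real.log (1 / (2 * ε)) := Real.log_nonneg (by
      rw [le_div_iff₀ (by linarith)]
      linarith)
    positivity
  -- With `e = 5 (β + 1) / (n + 2)`, the error is `1 / (n + 2)` from stopping, `e` for the
  -- expectation, and `√e` from Markov's inequality. Using `β + 1` keeps `e` positive even when `ε =
  -- 1/2` and `β = 0`.
  refine ⟨greedyProg, timeBound ⌈β⌉₊, _, tendsto_err (5 * (β + 1)), ?_⟩
  intro n f P O h0 hf hs hP hc hd hO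
  obtain ⟨T, hT⟩ : ∃ T, T = (n + 2) ^ 4 := ⟨_, rfl⟩
  have hT3 : 3 ≤ T := by
    have : 2 ^ 4 ≤ (n + 2) ^ 4 := Nat.pow_le_pow_left (by omega) 4
    omega
  obtain ⟨K, hlt, hK, hKβ⟩ := exists_steps hε0 hε hT3
  have hKB : K ≤ ⌈β⌉₊ * T := by
    have hT0 : (0 : ℝ) < T := by exact_mod_cast (by omega : 0 < T)
    rw [← hβ, div_le_iff₀ hT0] at hKβ
    have := hKβ.trans (mul_le_mul_of_nonneg_right (Nat.le_ceil β) hT0.le)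
    exact_mod_cast this
  have htime := eval_timeBound ⌈β⌉₊ n
  rw [← hT] at htime
  -- The tape is as long as the time bound, so the coins never run out.
  have hdepth : (greedy f O T K).DepthLE ((timeBound ⌈β⌉₊).eval n) := by
    refine (depthLE_greedy f O T K).mono ?_
    rw [htime]
    have h₁ : n * T ≤ n * (6 * T + 11) + 2 * n + 14 := by
      have := Nat.mul_le_mul_left n (by omega : T ≤ 6 * T + 11)
      omega
    have h₂ := Nat.mul_le_mul_left T h₁
    have h₃ := Nat.mul_le_mul hKB ((Nat.mul_le_mul_left n
      (h₂.trans (Nat.le_add_right _ 29))).trans (Nat.le_add_right _ 15))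
    omega
  have hrun : ∀ r : Fin ((timeBound ⌈β⌉₊).eval n) → Bool, ∃ o,
      (greedy f O T K).run (List.ofFn r) = some o := fun r =>
    DepthLE.exists_run (by rw [List.length_ofFn]; exact hdepth)
  choose out hout using hrun
  refine ⟨fun r => (out r).1, fun r => ?_, fun r => ?_, fun S hS => ?_⟩
  · obtain ⟨s', j, h₁, h₂, -, h₃⟩ :=
      sim_greedy (f := f) (O := O) (List.ofFn r) hT hlt hK (out r).1 (out r).2 (hout r)
    refine ⟨s', j, h₁, h₂.trans ?_, h₃⟩
    rw [htime]
    exact Nat.add_le_add_left (Nat.mul_le_mul_right _ hKB) _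
  · obtain ⟨h₁, y, hy, h₂⟩ := (all_greedy hO hd hc hP f (by omega : 2 ≤ T) K).of_run (hout r)
    refine ⟨fun u => ⟨(h₁ u).1, by linarith [(h₁ u).2]⟩, 0, zero_mem hO hd hP, y, hy,
      fun u => (h₁ u).1, h₂.trans fun u => ?_⟩
    exact mul_le_mul_of_nonneg_right hKβ (hP hy u).1
  · have hM := h0 S
    have hN : (0 : ℝ) < (n : ℝ) + 2 := by positivity
    have he : 0 < 5 * (β + 1) / ((n : ℝ) + 2) := by positivity
    have hbox : ∀ r, ∀ u, 0 ≤ (out r).1 u ∧ (out r).1 u ≤ 1 := fun r u => by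
      have := ((all_greedy hO hd hc hP f (by omega : 2 ≤ T) K).of_run (hout r)).1 u
      exact ⟨this.1, by linarith [this.2]⟩
    have hmean := mean_shortfall_le h0 hf hs hP hd hO hS hT hK hKβ
    have hE : ∀ φ : (Fin n → ℝ) → ℝ, coinExpect (fun r => φ (out r).1) =
        (greedy f O T K).mean φ := fun φ =>
      coinExpect_eq_mean hdepth φ (fun r => (out r).1) fun r => ⟨(out r).2, hout r⟩
    set e := 5 * (β + 1) / ((n : ℝ) + 2) with hedef
    have hse := Real.sqrt_nonneg e
    have hN' : 0 ≤ 1 / ((n : ℝ) + 2) := by positivity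
    refine ⟨?_, ?_⟩
    · rw [hE]
      refine le_trans ?_ (sub_le_mean hmean)
      rw [← sub_mul]
      refine mul_le_mul_of_nonneg_right ?_ hM
      linarith
    -- Markov's inequality divides by `f S`; if this vanishes, nonnegativity of `F` suffices.
    · rcases hM.eq_or_lt with hM0 | hMpos
      · have : ∀ r, (1 / 2 - ε - (1 / ((n : ℝ) + 2) + e + Real.sqrt e)) * f S ≤
            multilinearExt f (out r).1 := fun r => by
          rw [← hM0, mul_zero]
          exact multilinearExt_nonneg (hbox r) h0
        simp only [coinProb, this, if_true, coinExpect_const]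
        linarith
      · have h₁ := one_sub_sqrt_le_mean he hMpos hmean
        have h₂ : (greedy f O T K).mean (fun x => if (1 / 2 - ε - 1 / ((n : ℝ) + 2)) * f S -
            Real.sqrt e * f S ≤ multilinearExt f x then (1 : ℝ) else 0) ≤
            (greedy f O T K).mean (fun x => if (1 / 2 - ε - (1 / ((n : ℝ) + 2) + e + Real.sqrt e)) *
              f S ≤ multilinearExt f x then (1 : ℝ) else 0) := by
          refine mean_le_mean (All.of_forall _ fun x => ?_)
          split_ifs with h₃ h₄
          · exact le_rfl
          · refine absurd (le_trans ?_ h₃) h₄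
            rw [← sub_mul]
            exact mul_le_mul_of_nonneg_right (by linarith) hM
          · exact zero_le_one
          · exact le_rfl
        have h₃ := h₁.trans h₂
        rw [← hE] at h₃
        refine le_trans (by linarith) (h₃.trans (le_of_eq ?_))
        simp only [coinProb]
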